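/- Let $G=(V,E)$ be a finite, simple, connected, undirected graph with positive edge weights $\omega_{ij}=\omega_{ji}>0$ for $ij\in E$, extended by $\omega_{ij}=0$ for $ij\notin E$, and let $d_i=\sum_j\omega_{ij}$. Fix $r\in[0,1]$; if $|V|=1$ assume $r=0$ (with $0^0=1$). For $u,v:V\to\mathbb R$ put $$\langle u,v\rangle=\sum_{i\in V}u_iv_id_i^{\,r},\qquad \bar u=\frac{\langle u,\mathbf 1\rangle}{\langle\mathbf 1,\mathbf 1\rangle},\qquad (\Delta u)_i=d_i^{-r}\sum_{j\in V}\omega_{ij}(u_i-u_j),\qquad e^{-t\Delta}=\sum_{n\ge0}\frac{(-t)^n}{n!}\Delta^n .$$ Write $\mathcal V=\{u:V\to\mathbb R\}$ and $\mathcal V_{[0,1]}=\{u:V\to[0,1]\}$. Let $\mathcal B(u)=\emptyset$ if $u\notin\mathcal V_{[0,1]}$; for $u\in\mathcal V_{[0,1]}$ let $\mathcal B(u)$ be the set of $\beta\in\mathcal V$ with $\beta_i\ge0$ where $u_i=0$, $\beta_i=0$ where $0<u_i<1$, and $\beta_i\le0$ where $u_i=1$. Let $\varepsilon>0$ and $T=[0,\infty)$.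 The spaces $L^2_{loc}(T;\mathcal V)$, $L^\infty_{loc}(T;\mathcal V)$ and $H^1_{loc}(T;\mathcal V)$ consist of the functions that belong to $L^2$, $L^\infty$, $H^1$ on $(a,b)$ for all $a,b\in T$ (so that "locally" means on bounded subintervals of $T$), with the pairing $\int\langle u(t),v(t)\rangle\,dt$. A pair $(u,\beta)$ with $u:T\to\mathcal V_{[0,1]}$ and $\beta:T\to\mathcal V$ is a *solution of mass-conserving double-obstacle Allen–Cahn flow* if $u\in H^1_{loc}(T;\mathcal V)\cap C^0(T;\mathcal V)$ and, for a.e. $t\in T$, $$\varepsilon\frac{du}{dt}+\varepsilon\Delta u(t)-u(t)+\overline{u(t)}\,\mathbf 1=\beta(t)-\overline{\beta(t)}\,\mathbf 1,\qquad \beta(t)\in\mathcal B(u(t)),$$ where $du/dt$ is the weak derivative. For $\tau>0$ and $\lambda=\tau/\varepsilon$, *semi-discrete iterates* with time step $\tau$ and initial state $u_0$ are sequences $(u_m)_{m\ge 0}$, $(\beta_m)_{m\ge1}$ in $\mathcal V$ that start at the given $u_0$ and satisfy, for all $m\ge0$, $$u_{m+1}-e^{-\tau\Delta}u_m-\lambda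 u_{m+1}+\lambda\,\overline{u_{m+1}}\,\mathbf 1=\lambda\beta_{m+1}-\lambda\,\overline{\beta_{m+1}}\,\mathbf 1,\qquad \beta_{m+1}\in\mathcal B(u_{m+1}).$$ **Theorem.** Let $u_0\in\mathcal V_{[0,1]}$. 1. There is a solution $(u,\beta)$ of mass-conserving double-obstacle Allen–Cahn flow on $[0,\infty)$ with $u(0)=u_0$. 2. For every $\tau\in(0,\varepsilon)$ there are semi-discrete iterates with time step $\tau$ and initial state $u_0$. 3. Suppose that $u_0\neq\mathbf 0$ and $u_0\neq\mathbf 1$. Let $\tau_n>0$ with $\tau_n\to0$, and for each $n$ with $\tau_n<\varepsilon$ let $(u^{[\tau_n]}_m,\beta^{[\tau_n]}_m)$ be any semi-discrete iterates with time step $\tau_n$ and initial state $u_0$. Then there are a subsequence $(\tau_n')_{n\ge1}$ of $(\tau_n)$ with $\tau_n'<\varepsilon$ for all $n$, and a solution $(\hat u,\gamma)$ of mass-conserving double-obstacle Allen–Cahn flow on $[0,\infty)$ with $\hat u(0)=u_0$, such that - $t\mapsto\beta^{[\tau'_n]}_{\lceil t/\tau'_n\rceil}$ converges to $\gamma$ weakly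 in $L^2_{loc}([0,\infty);\mathcal V)$ and weakly-* in $L^\infty_{loc}([0,\infty);\mathcal V)$; - for every $t\ge0$, $u^{[\tau'_n]}_{\lceil t/\tau'_n\rceil}\to\hat u(t)$ as $n\to\infty$; - there is a sequence of integers $N_k\to\infty$ such that, for a.e. $t\ge0$, $\frac1{N_k}\sum_{n=1}^{N_k}\beta^{[\tau'_n]}_{\lceil t/\tau'_n\rceil}\to\gamma(t)$ as $k\to\infty$. -/

import Mathlib

open Set Filter Topology MeasureTheory
open scoped ContDiff

noncomputable section

namespace GraphAC

/-- A connected, undirected, simple graph with positive edge weights (extended by zero to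
non-edges). -/
structure WeightedGraph (V : Type*) where
  graph : SimpleGraph V
  connected : graph.Connected
  weight : V → V → ℝ
  weight_symm : ∀ i j, weight i j = weight j i
  weight_pos : ∀ i j, graph.Adj i j → 0 < weight i j
  weight_zero : ∀ i j, ¬ graph.Adj i j → weight i j = 0

section Graph

variable {V : Type*} [Fintype V] (G : WeightedGraph V) (r : ℝ)

/-- The degree `d_i = ∑_j ω_{ij}`. -/
def WeightedGraph.deg (i : V) : ℝ := ∑ j, G.weight i j

/-- The inner product `⟨u, v⟩ = ∑_i u_i v_i d_i ^ r` on vertex functions. -/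
def ip (u v : V → ℝ) : ℝ := ∑ i, u i * v i * G.deg i ^ r

/-- The average value `⟨u, 1⟩ / ⟨1, 1⟩`. -/
def avg (u : V → ℝ) : ℝ := ip G r u 1 / ip G r 1 1

/-- The graph Laplacian `(Δ u)_i = d_i ^ (-r) ∑_j ω_{ij} (u_i - u_j)`. -/
def laplacian : (V → ℝ) →ₗ[ℝ] (V → ℝ) where
  toFun u := fun i => G.deg i ^ (-r) * ∑ j, G.weight i j * (u i - u j)
  map_add' u v := by
    funext i
    simp only [Pi.add_apply]
    rw [← mul_add, ← Finset.sum_add_distrib]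
    congr 1
    exact Finset.sum_congr rfl fun j _ => by ring
  map_smul' c u := by
    funext i
    simp only [Pi.smul_apply, smul_eq_mul, RingHom.id_apply, Finset.mul_sum]
    exact Finset.sum_congr rfl fun j _ => by ring

/-- The graph diffusion operator `e^{-tΔ}`, given by the exponential series. -/
def diffusion (t : ℝ) : (V → ℝ) →L[ℝ] (V → ℝ) :=
  NormedSpace.exp ((-t) • LinearMap.toContinuousLinearMap (laplacian G r))

end Graph

/-- The set `𝓑(u)` of all `β` with `β_i ∈ -∂I_{[0,1]}(u_i)` for every vertex `i`: it is empty unless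
`u` takes values in `[0,1]`, and then `β_i` ranges over `[0,∞)`, `{0}`, `(-∞,0]` according to
`u_i = 0`, `0 < u_i < 1`, `u_i = 1`. -/
def obstacleSet {V : Type*} (u : V → ℝ) : Set (V → ℝ) :=
  {β | ∀ i, u i ∈ Icc (0 : ℝ) 1 ∧ (u i = 0 → 0 ≤ β i) ∧ (u i ∈ Ioo (0 : ℝ) 1 → β i = 0) ∧
    (u i = 1 → β i ≤ 0)}

section Spaces

variable {V : Type*} [Fintype V] (G : WeightedGraph V) (r : ℝ)

/-- `L^p((a,b); 𝓥)`. The norm on `V → ℝ` is the maximum norm; all norms on this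
finite-dimensional space are equivalent. -/
def MemLpOn (p : ENNReal) (a b : ℝ) (u : ℝ → V → ℝ) : Prop :=
  MemLp u p (volume.restrict (Ioo a b))

/-- The pairing `(u, v)_{t ∈ (a,b)} = ∫_a^b ⟨u(t), v(t)⟩ dt`. -/
def pairing (a b : ℝ) (u v : ℝ → V → ℝ) : ℝ := ∫ t in Ioo a b, ip G r (u t) (v t)

/-- `v` is a square integrable weak derivative of the square integrable function `u` on `(a,b)`. -/
def HasWeakDerivOn (a b : ℝ) (u v : ℝ → V → ℝ) : Prop :=
  MemLpOn 2 a b u ∧ MemLpOn 2 a b v ∧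
    ∀ φ : ℝ → V → ℝ, ContDiff ℝ ∞ φ → HasCompactSupport φ → tsupport φ ⊆ Ioo a b →
      pairing G r a b u (deriv φ) = - pairing G r a b v φ

/-- `u ∈ H¹_loc(T; 𝓥)` with weak derivative `v`: for all `a, b ∈ T` we have `u ∈ H¹((a,b); 𝓥)` with
weak derivative `v`. -/
def HasWeakDerivLoc (T : Set ℝ) (u v : ℝ → V → ℝ) : Prop :=
  ∀ a ∈ T, ∀ b ∈ T, HasWeakDerivOn G r a b u v

/-- `f_n` converges to `g` weakly in `L²_loc(T; 𝓥)`, i.e. weakly in `L²((a,b); 𝓥)` for all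
`a, b ∈ T`. -/
def WeakConvL2Loc (T : Set ℝ) (f : ℕ → ℝ → V → ℝ) (g : ℝ → V → ℝ) : Prop :=
  ∀ a ∈ T, ∀ b ∈ T, (∀ n, MemLpOn 2 a b (f n)) ∧ MemLpOn 2 a b g ∧
    ∀ h : ℝ → V → ℝ, MemLpOn 2 a b h →
      Tendsto (fun n => pairing G r a b (f n) h) atTop (𝓝 (pairing G r a b g h))

/-- `f_n` converges to `g` weakly* in `L^∞_loc(T; 𝓥)`, i.e. for all `a, b ∈ T`, weakly* in
`L^∞((a,b); 𝓥)` as the dual of `L¹((a,b); 𝓥)`. -/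
def WeakStarConvLinftyLoc (T : Set ℝ) (f : ℕ → ℝ → V → ℝ) (g : ℝ → V → ℝ) : Prop :=
  ∀ a ∈ T, ∀ b ∈ T, (∀ n, MemLpOn ⊤ a b (f n)) ∧ MemLpOn ⊤ a b g ∧
    ∀ h : ℝ → V → ℝ, MemLpOn 1 a b h →
      Tendsto (fun n => pairing G r a b (f n) h) atTop (𝓝 (pairing G r a b g h))

/-- `(u, β)` is a solution to mass-conserving double-obstacle Allen–Cahn flow on the interval `T`.
Only the values of `u` and `β` on `T` matter. -/
def IsACSolution (ε : ℝ) (T : Set ℝ) (u β : ℝ → V → ℝ) : Prop :=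
  (∀ t ∈ T, ∀ i, u t i ∈ Icc (0 : ℝ) 1) ∧ ContinuousOn u T ∧
    ∃ du : ℝ → V → ℝ, HasWeakDerivLoc G r T u du ∧
      ∀ᵐ t ∂(volume.restrict T),
        (∀ i, ε * du t i + ε * laplacian G r (u t) i - u t i + avg G r (u t)
            = β t i - avg G r (β t)) ∧
          β t ∈ obstacleSet (u t)

/-- `(u_m, β_m)` are iterates of the mass-conserving semi-discrete scheme with time step `τ` and
initial state `u₀`, where `λ = τ / ε`. The scheme does not involve `β_0`, which is arbitrary. -/
def IsSemiDiscrete (ε τ : ℝ) (u₀ : V → ℝ) (u β : ℕ → V → ℝ) : Prop :=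
  u 0 = u₀ ∧ ∀ m,
    (∀ i, u (m + 1) i - diffusion G r τ (u m) i - τ / ε * u (m + 1) i
          + τ / ε * avg G r (u (m + 1))
        = τ / ε * β (m + 1) i - τ / ε * avg G r (β (m + 1))) ∧
      β (m + 1) ∈ obstacleSet (u (m + 1))

end Spaces

end GraphAC

end

/-! Averaging a step of the scheme removes every mean-free term, and diffusion preserves the
average, so the mass `m` of `u₀` is conserved (`IsSemiDiscrete.avg_eq`). It lies strictly between 0
and 1 unless `u₀` is `0` or `1`. Solving the scheme for `β - avg β`, the only term of order `1/τ` is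
the difference quotient of `u`, which is nonpositive where the new state is 0 and nonnegative where
it is 1. Hence `β` exceeds its average by at most a constant `K` on the first set, and falls below
it by at most `K` on the second. Since `β` vanishes elsewhere, comparison with multiples of `1 - w`
and `w` and averaging bounds `β` by `K/m + K/(1-m)` (`abs_le_of_mem_obstacleSet`). So the
multipliers are bounded and the increments are `O(τ)`, uniformly in `τ`
(`exists_bound_isSemiDiscrete`).

Compactness then gives pointwise limits of the states (`exists_subseq_tendsto_pointwise`), and weak
limits of the multipliers whose arithmetic means converge a.e. by Banach–Saks
(`exists_subseq_weak_cesaro_Ioi`). The time-integrated equation is linear in `β`, so weak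
convergence suffices there (`eq_add_integral_velocity`). The inclusion is not linear, but its sign
conditions are convex and survive averaging (`mem_obstacleSet_of_tendsto_mean`).

A scheme step is solved by clipping `(v + c)/(1 - λ)` to `[0,1]`, with `c` fixed by the mass
(`exists_scheme_step`). Existence for the flow follows by letting `τ → 0`; the states `0` and `1`
are stationary. -/

noncomputable section

namespace GraphAC

/-! ### Weak compactness and Banach–Saks in Hilbert space. -/

section FunctionalAnalysis

open scoped InnerProductSpace

variable {H : Type*} [NormedAddCommGroup H] [InnerProductSpace ℝ H]

/-- Bounded sequences in a separable Hilbert space have weakly convergent subsequences. -/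
theorem exists_weakly_tendsto_subseq [CompleteSpace H] [TopologicalSpace.SeparableSpace H]
    (x : ℕ → H) (M : ℝ) (hx : ∀ n, ‖x n‖ ≤ M) :
    ∃ (φ : ℕ → ℕ) (y : H), StrictMono φ ∧
      ∀ h : H, Tendsto (fun n => ⟪x (φ n), h⟫_ℝ) atTop (𝓝 ⟪y, h⟫_ℝ) := by
  have hc := WeakDual.isSeqCompact_closedBall ℝ H (0 : StrongDual ℝ H) M
  obtain ⟨a, -, φ, hφ, hlim⟩ := hc (x := fun n =>
      StrongDual.toWeakDual (InnerProductSpace.toDual ℝ H (x n))) (fun n => by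
    simpa [mem_preimage, Metric.mem_closedBall, dist_zero_right] using hx n)
  refine ⟨φ, (InnerProductSpace.toDual ℝ H).symm (WeakDual.toStrongDual a), hφ, fun h => ?_⟩
  rw [InnerProductSpace.toDual_symm_apply]
  have := ((WeakDual.eval_continuous (𝕜 := ℝ) h).tendsto a).comp hlim
  exact this

/-- The Banach–Saks theorem in Hilbert space. -/
theorem exists_cesaro_tendsto_zero (x : ℕ → H) (M : ℝ) (hx : ∀ n, ‖x n‖ ≤ M)
    (hw : ∀ h : H, Tendsto (fun n => ⟪x n, h⟫_ℝ) atTop (𝓝 0)) :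
    ∃ φ : ℕ → ℕ, StrictMono φ ∧
      Tendsto (fun N : ℕ => (N : ℝ)⁻¹ • ∑ n ∈ Finset.range N, x (φ n)) atTop (𝓝 0) := by
  -- By weak convergence to 0, each new term can be chosen nearly orthogonal to all earlier ones.
  have step : ∀ k m : ℕ, ∃ n, m < n ∧ ∀ i ∈ Finset.range (m + 1),
      |⟪x n, x i⟫_ℝ| < ((k : ℝ) + 1)⁻¹ := by
    intro k m
    have h1 : ∀ᶠ n in atTop, ∀ i ∈ Finset.range (m + 1), |⟪x n, x i⟫_ℝ| < ((k : ℝ) + 1)⁻¹ := by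
      rw [Filter.eventually_all_finset]
      intro i _
      have := (hw (x i)).abs
      rw [abs_zero] at this
      exact this.eventually_lt_const (by positivity)
    exact ((eventually_gt_atTop m).and h1).exists
  choose f hf1 hf2 using step
  let φ : ℕ → ℕ := fun k => Nat.rec 0 (fun k m => f k m) k
  have hφs : ∀ k, φ (k + 1) = f k (φ k) := fun k => rfl
  have hφ : StrictMono φ := strictMono_nat_of_lt_succ fun k => by rw [hφs]; exact hf1 _ _
  refine ⟨φ, hφ, ?_⟩
  have hin : ∀ N j, j < N → |⟪x (φ j), x (φ N)⟫_ℝ| ≤ (N : ℝ)⁻¹ := by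
    intro N j hj
    obtain ⟨k, rfl⟩ : ∃ k, N = k + 1 := ⟨N - 1, by omega⟩
    rw [real_inner_comm, hφs]
    have := hf2 k (φ k) (φ j) (by
      rw [Finset.mem_range]; exact Nat.lt_succ_of_le (hφ.monotone (by omega)))
    push_cast
    exact this.le
  -- The `N` cross terms with `x (φ N)` are at most `1/N` each, so the squared norm grows only
  -- linearly and the means are `O(N^(-1/2))`.
  have hs : ∀ N : ℕ, ‖∑ n ∈ Finset.range N, x (φ n)‖ ^ 2 ≤ N * (2 + M ^ 2) := by
    intro N
    induction N with
    | zero => simp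
    | succ N ih =>
      rw [Finset.sum_range_succ, norm_add_sq_real, sum_inner]
      have h1 : ∑ i ∈ Finset.range N, ⟪x (φ i), x (φ N)⟫_ℝ ≤ 1 := by
        calc _ ≤ ∑ i ∈ Finset.range N, (N : ℝ)⁻¹ :=
              Finset.sum_le_sum fun i hi =>
                (le_abs_self _).trans (hin N i (Finset.mem_range.1 hi))
          _ ≤ 1 := by
            rw [Finset.sum_const, Finset.card_range, nsmul_eq_mul]
            exact mul_inv_le_one
      have h2 : ‖x (φ N)‖ ^ 2 ≤ M ^ 2 := pow_le_pow_left₀ (norm_nonneg _) (hx _) 2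
      push_cast
      nlinarith
  have hb : Tendsto (fun N : ℕ => Real.sqrt ((2 + M ^ 2) * (N : ℝ)⁻¹)) atTop (𝓝 0) := by
    have : Tendsto (fun N : ℕ => (2 + M ^ 2) * (N : ℝ)⁻¹) atTop (𝓝 ((2 + M ^ 2) * 0)) :=
      tendsto_inv_atTop_nhds_zero_nat.const_mul _
    have h0 := (Real.continuous_sqrt.tendsto _).comp this
    rwa [mul_zero, Real.sqrt_zero] at h0
  refine squeeze_zero_norm (fun N => ?_) hb
  apply Real.le_sqrt_of_sq_le
  rw [norm_smul, mul_pow, norm_inv, Real.norm_natCast]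
  rcases Nat.eq_zero_or_pos N with rfl | hN
  · simp
  · have hN' : (0 : ℝ) < N := by exact_mod_cast hN
    calc _ ≤ ((N : ℝ)⁻¹) ^ 2 * (N * (2 + M ^ 2)) := by gcongr; exact hs N
      _ = _ := by field_simp

end FunctionalAnalysis

/-! ### Weak compactness of bounded functions. -/

section Compactness

variable {Ω : Type*} [MeasurableSpace Ω] {V : Type*} [Fintype V]

/-- Weak convergence of a bounded sequence tested against bounded functions extends to integrable
test functions. -/
theorem tendsto_integral_mul_of_bounded_tests (μ : Measure Ω) [IsFiniteMeasure μ]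
    (f : ℕ → Ω → ℝ) (g : Ω → ℝ) (C : ℝ) (hf : ∀ n, Measurable (f n)) (hg : Measurable g)
    (hfC : ∀ n, ∀ᵐ t ∂μ, |f n t| ≤ C) (hgC : ∀ᵐ t ∂μ, |g t| ≤ C)
    (hw : ∀ k : Ω → ℝ, AEStronglyMeasurable k μ → (∃ B, ∀ t, |k t| ≤ B) →
      Tendsto (fun n => ∫ t, f n t * k t ∂μ) atTop (𝓝 (∫ t, g t * k t ∂μ)))
    (k : Ω → ℝ) (hk : Integrable k μ) :
    Tendsto (fun n => ∫ t, f n t * k t ∂μ) atTop (𝓝 (∫ t, g t * k t ∂μ)) := by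
  -- Truncations of `k` are bounded tests converging to `k` in L¹; the error in the pairing is at
  -- most `C ‖k - T M‖₁`, uniformly in `n`.
  let T : ℕ → Ω → ℝ := fun M t => max (-(M : ℝ)) (min M (k t))
  have hTm : ∀ M, AEStronglyMeasurable (T M) μ := fun M =>
    (continuous_const.max (continuous_const.min continuous_id)).comp_aestronglyMeasurable
      hk.aestronglyMeasurable
  have hTb : ∀ M t, |T M t| ≤ M := fun M t => by
    rw [abs_le]
    exact ⟨le_max_left _ _, max_le (by linarith [(Nat.cast_nonneg M : (0 : ℝ) ≤ M)])
      (min_le_left _ _)⟩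
  have hTk : ∀ M t, |k t - T M t| ≤ |k t| := fun M t => by
    have hM : (0 : ℝ) ≤ M := Nat.cast_nonneg M
    simp only [T]
    rcases le_total (k t) 0 with h | h
    · rw [min_eq_right (h.trans hM)]
      rcases le_total (-(M : ℝ)) (k t) with h' | h'
      · rw [max_eq_right h']; simp
      · rw [max_eq_left h', abs_of_nonpos h, abs_of_nonpos (by linarith)]; linarith
    · rw [max_eq_right (by linarith [le_min hM h])]
      rcases le_total (k t) M with h' | h'
      · rw [min_eq_right h']; simp
      · rw [min_eq_left h', abs_of_nonneg h, abs_of_nonneg (by linarith)]; linarith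
  have hTi : ∀ M, Integrable (T M) μ := fun M =>
    Integrable.of_bound (hTm M) M (Eventually.of_forall (hTb M))
  have hlim : Tendsto (fun M => ∫ t, |k t - T M t| ∂μ) atTop (𝓝 0) := by
    have := tendsto_integral_of_dominated_convergence (μ := μ)
      (F := fun M t => |k t - T M t|) (f := fun _ => 0) (fun t => |k t|)
      (fun M => (hk.sub (hTi M)).abs.aestronglyMeasurable) hk.abs
      (fun M => Eventually.of_forall fun t => by
        rw [Real.norm_eq_abs, abs_abs]; exact hTk M t)
      (Eventually.of_forall fun t => by
        refine tendsto_const_nhds.congr' ?_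
        obtain ⟨M₀, hM₀⟩ := exists_nat_ge |k t|
        filter_upwards [eventually_ge_atTop M₀] with M hM
        have hM' : |k t| ≤ M := hM₀.trans (by exact_mod_cast hM)
        rw [abs_le] at hM'
        simp only [T]
        rw [min_eq_right hM'.2, max_eq_right hM'.1, sub_self, abs_zero])
    simpa using this
  have hmul : ∀ F : Ω → ℝ, Measurable F → (∀ᵐ t ∂μ, |F t| ≤ C) → ∀ l : Ω → ℝ,
      Integrable l μ → Integrable (fun t => F t * l t) μ := fun F hF hFC l hl =>
    hl.bdd_mul hF.aestronglyMeasurable (by simpa only [Real.norm_eq_abs] using hFC)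
  have hC : ∀ F : Ω → ℝ, Measurable F → (∀ᵐ t ∂μ, |F t| ≤ C) → ∀ M,
      |∫ t, F t * k t ∂μ - ∫ t, F t * T M t ∂μ| ≤ C * ∫ t, |k t - T M t| ∂μ := by
    intro F hF hFC M
    rw [← integral_sub (hmul F hF hFC k hk) (hmul F hF hFC _ (hTi M)), ← integral_const_mul,
      ← Real.norm_eq_abs]
    refine norm_integral_le_of_norm_le ((hk.sub (hTi M)).abs.const_mul C) ?_
    filter_upwards [hFC] with t ht
    rw [← mul_sub, Real.norm_eq_abs, abs_mul]
    exact mul_le_mul_of_nonneg_right ht (abs_nonneg _)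
  rw [Metric.tendsto_atTop]
  intro e he
  have hlimC := hlim.const_mul C
  rw [mul_zero] at hlimC
  obtain ⟨M, hM⟩ := (hlimC.eventually_lt_const (show 0 < e / 3 by positivity)).exists
  obtain ⟨n₀, hn₀⟩ := Metric.tendsto_atTop.1 (hw (T M) (hTm M) ⟨M, hTb M⟩) (e / 3) (by positivity)
  refine ⟨n₀, fun n hn => ?_⟩
  have h1 := hC (f n) (hf n) (hfC n) M
  have h2 := hC g hg hgC M
  have h3 := hn₀ n hn
  rw [Real.dist_eq] at h3 ⊢
  rw [abs_lt] at h3 ⊢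
  rw [abs_le] at h1 h2
  constructor <;> linarith [h1.1, h1.2, h2.1, h2.2, h3.1, h3.2]

/-- A uniformly bounded sequence of functions on a finite measure space has a subsequence that
converges weakly and whose arithmetic means converge almost everywhere along a subsequence. -/
theorem exists_subseq_weak_cesaro (μ : Measure Ω) [IsFiniteMeasure μ]
    [MeasurableSpace.CountablyGenerated Ω] (f : ℕ → Ω → V → ℝ) (C : ℝ)
    (hC : 0 ≤ C) (hf : ∀ n, Measurable (f n)) (hfC : ∀ n, ∀ᵐ t ∂μ, ∀ i, |f n t i| ≤ C) :
    ∃ (φ : ℕ → ℕ) (γ : Ω → V → ℝ), StrictMono φ ∧ Measurable γ ∧ (∀ t i, |γ t i| ≤ C) ∧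
      (∀ i (k : Ω → ℝ), Integrable k μ →
        Tendsto (fun n => ∫ t, f (φ n) t i * k t ∂μ) atTop (𝓝 (∫ t, γ t i * k t ∂μ))) ∧
      ∃ N : ℕ → ℕ, Tendsto N atTop atTop ∧ ∀ᵐ t ∂μ,
        Tendsto (fun j => ((N j : ℝ))⁻¹ • ∑ n ∈ Finset.range (N j), f (φ n) t) atTop
          (𝓝 (γ t)) := by
  classical
  -- The maximum norm on `V → ℝ` is not Hilbertian; the Euclidean copy makes L² a Hilbert space.
  let E := EuclideanSpace ℝ V
  let f' : ℕ → Ω → E := fun n t => WithLp.toLp 2 (f n t)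
  have hf'm : ∀ n, Measurable (f' n) := fun n =>
    (PiLp.continuous_toLp 2 (fun _ : V => ℝ)).measurable.comp (hf n)
  let M : ℝ := Real.sqrt (∑ _i : V, C ^ 2)
  have hf'b : ∀ n, ∀ᵐ t ∂μ, ‖f' n t‖ ≤ M := fun n => by
    filter_upwards [hfC n] with t ht
    rw [EuclideanSpace.norm_eq]
    refine Real.sqrt_le_sqrt (Finset.sum_le_sum fun i _ => ?_)
    exact pow_le_pow_left₀ (norm_nonneg _) (ht i) 2
  have hf'L : ∀ n, MemLp (f' n) 2 μ := fun n =>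
    MemLp.of_bound (hf'm n).aestronglyMeasurable M (hf'b n)
  let x : ℕ → Lp E 2 μ := fun n => (hf'L n).toLp (f' n)
  have hxb : ∃ B, ∀ n, ‖x n‖ ≤ B := by
    refine ⟨_, fun n => Lp.norm_le_of_ae_bound (C := M) (Real.sqrt_nonneg _) ?_⟩
    filter_upwards [hf'b n, (hf'L n).coeFn_toLp] with t h1 h2
    rw [h2]; exact h1
  obtain ⟨B, hB⟩ := hxb
  have : Fact ((1 : ENNReal) ≤ 2) := ⟨by norm_num⟩
  have : Fact ((2 : ENNReal) ≠ ⊤) := ⟨by norm_num⟩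
  obtain ⟨φ₁, y, hφ₁, hy⟩ := exists_weakly_tendsto_subseq x B hB
  obtain ⟨φ₂, hφ₂, hces⟩ := exists_cesaro_tendsto_zero (fun n => x (φ₁ n) - y) (B + ‖y‖)
    (fun n => (norm_sub_le _ _).trans (by gcongr; exact hB _))
    (fun h => by
      simp only [inner_sub_left]
      simpa using (hy h).sub_const (inner ℝ y h))
  let φ : ℕ → ℕ := φ₁ ∘ φ₂
  have hces' : Tendsto (fun N : ℕ => (N : ℝ)⁻¹ • ∑ n ∈ Finset.range N, x (φ n)) atTop (𝓝 y) := by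
    have h1 : Tendsto (fun N : ℕ => ((N : ℝ)⁻¹ • ∑ n ∈ Finset.range N, (x (φ₁ (φ₂ n)) - y)) + y)
        atTop (𝓝 y) := by simpa using hces.add_const y
    refine h1.congr' ?_
    filter_upwards [eventually_gt_atTop 0] with N hN
    rw [Finset.sum_sub_distrib, smul_sub, Finset.sum_const, Finset.card_range,
      ← Nat.cast_smul_eq_nsmul ℝ, smul_smul, inv_mul_cancel₀ (by positivity), one_smul]
    simp [φ]
  -- Only the lengths of the means are thinned out here; `φ` stays the same.
  obtain ⟨N, hN, hNae⟩ := (tendstoInMeasure_of_tendsto_Lp hces').exists_seq_tendsto_ae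
  have hsum : ∀ᵐ t ∂μ, ∀ m : ℕ, (((m : ℝ)⁻¹ • ∑ n ∈ Finset.range m, x (φ n) : Lp E 2 μ) : Ω → E) t
      = WithLp.toLp 2 ((m : ℝ)⁻¹ • ∑ n ∈ Finset.range m, f (φ n) t) := by
    rw [ae_all_iff]
    intro m
    have hx : ∀ᵐ t ∂μ, ∀ n, x n t = f' n t := ae_all_iff.2 fun n => (hf'L n).coeFn_toLp
    have hS : ∀ m : ℕ, ∀ᵐ t ∂μ, ((∑ n ∈ Finset.range m, x (φ n) : Lp E 2 μ) : Ω → E) t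
        = ∑ n ∈ Finset.range m, f' (φ n) t := by
      intro m
      induction m with
      | zero =>
        simp only [Finset.range_zero, Finset.sum_empty]
        filter_upwards [Lp.coeFn_zero E 2 μ] with t ht using ht
      | succ m ih =>
        filter_upwards [ih, hx, Lp.coeFn_add (∑ n ∈ Finset.range m, x (φ n)) (x (φ m))]
          with t h1 h2 h3
        rw [Finset.sum_range_succ, Finset.sum_range_succ, h3, Pi.add_apply, h1, h2]
    filter_upwards [hS m, Lp.coeFn_smul ((m : ℝ)⁻¹) (∑ n ∈ Finset.range m, x (φ n))] with t h1 h2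
    rw [h2, Pi.smul_apply, h1, WithLp.toLp_smul, WithLp.toLp_sum]
  -- Clipping picks a representative of `y` that is bounded by `C` everywhere; it agrees with `y`
  -- a.e. because the means stay in `[-C, C]`.
  let γ : Ω → V → ℝ := fun t i => max (-C) (min C (y t i))
  have hγm : Measurable γ := by
    have hy' : Measurable (y : Ω → E) := (Lp.stronglyMeasurable y).measurable
    refine measurable_pi_iff.2 fun i => measurable_const.max (measurable_const.min ?_)
    exact (EuclideanSpace.proj (𝕜 := ℝ) i).continuous.measurable.comp hy'
  have hγb : ∀ t i, |γ t i| ≤ C := fun t i => by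
    rw [abs_le]
    exact ⟨le_max_left _ _, max_le (by linarith) (min_le_left _ _)⟩
  have hconv : ∀ᵐ t ∂μ, ∀ i, Tendsto
      (fun j => ((N j : ℝ)⁻¹ • ∑ n ∈ Finset.range (N j), f (φ n) t) i) atTop (𝓝 (y t i)) := by
    filter_upwards [hNae, hsum] with t h1 h2 i
    have h3 := ((EuclideanSpace.proj (𝕜 := ℝ) i).continuous.tendsto (y t)).comp h1
    refine h3.congr fun j => ?_
    simp only [Function.comp_apply]
    rw [h2]
    simp
  have hyγ : ∀ᵐ t ∂μ, ∀ i, γ t i = y t i := by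
    filter_upwards [hconv, ae_all_iff.2 hfC] with t h1 h2 i
    have hmem : ∀ j, (((N j : ℝ)⁻¹ • ∑ n ∈ Finset.range (N j), f (φ n) t) i) ∈ Icc (-C) C := by
      intro j
      rw [mem_Icc, ← abs_le, Pi.smul_apply, Finset.sum_apply, smul_eq_mul, abs_mul, abs_inv, Nat.abs_cast]
      rcases Nat.eq_zero_or_pos (N j) with h0 | h0
      · simp [h0, hC]
      · rw [inv_mul_le_iff₀ (by exact_mod_cast h0)]
        calc _ ≤ ∑ n ∈ Finset.range (N j), |f (φ n) t i| := Finset.abs_sum_le_sum_abs _ _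
          _ ≤ ∑ n ∈ Finset.range (N j), C := Finset.sum_le_sum fun n _ => h2 _ i
          _ = _ := by simp
    have := isClosed_Icc.mem_of_tendsto (h1 i) (Eventually.of_forall hmem)
    simp only [γ]
    rw [min_eq_right this.2, max_eq_right this.1]
  refine ⟨φ, γ, hφ₁.comp hφ₂, hγm, hγb, fun i k hk => ?_, N, hN.tendsto_atTop, ?_⟩
  · refine tendsto_integral_mul_of_bounded_tests μ (fun n t => f (φ n) t i) (fun t => γ t i) C
      (fun n => (measurable_pi_apply i).comp (hf _)) ((measurable_pi_apply i).comp hγm)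
      (fun n => (hfC _).mono fun t h => h i) (Eventually.of_forall fun t => hγb t i) ?_ k hk
    rintro k hk ⟨B', hB'⟩
    have hh : MemLp (fun t => EuclideanSpace.single i (k t) : Ω → E) 2 μ := by
      refine MemLp.of_bound ?_ B' (Eventually.of_forall fun t => ?_)
      · have : Continuous (fun a : ℝ => (EuclideanSpace.single i a : E)) := by
          have h0 : (fun a : ℝ => (EuclideanSpace.single i a : E))
            = fun a => a • EuclideanSpace.single i (1 : ℝ) := by
            funext a
            ext j
            by_cases hj : j = i <;> simp [hj]
          rw [h0]
          fun_prop
        exact this.comp_aestronglyMeasurable hk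
      · simpa using hB' t
    have hlim := (hy (hh.toLp _)).comp hφ₂.tendsto_atTop
    have hval : ∀ (z : Lp E 2 μ) (g : Ω → ℝ), (∀ᵐ t ∂μ, z t i = g t) →
        inner ℝ z (hh.toLp _) = ∫ t, g t * k t ∂μ := by
      intro z g hg
      rw [L2.inner_def]
      refine integral_congr_ae ?_
      filter_upwards [hg, hh.coeFn_toLp] with t h1 h2
      rw [h2, EuclideanSpace.inner_single_right, h1]
      simp [mul_comm]
    rw [hval y (fun t => γ t i) (hyγ.mono fun t h => (h i).symm)] at hlim
    refine hlim.congr fun n => ?_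
    simp only [Function.comp_apply]
    refine hval _ _ ?_
    filter_upwards [(hf'L (φ n)).coeFn_toLp] with t ht
    exact congrArg (fun v : E => v i) ht
  · filter_upwards [hconv, hyγ] with t h1 h2
    rw [tendsto_pi_nhds]
    intro i
    rw [h2]
    exact h1 i

/-- Weak-* compactness, with almost everywhere convergent arithmetic means, of uniformly bounded
functions on the half-line. -/
theorem exists_subseq_weak_cesaro_Ioi (f : ℕ → ℝ → V → ℝ) (C : ℝ)
    (hC : 0 ≤ C) (hf : ∀ n, Measurable (f n)) (hfC : ∀ n, ∀ t > 0, ∀ i, |f n t i| ≤ C) :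
    ∃ (φ : ℕ → ℕ) (γ : ℝ → V → ℝ), StrictMono φ ∧ Measurable γ ∧ (∀ t i, |γ t i| ≤ C) ∧
      (∀ i (k : ℝ → ℝ), IntegrableOn k (Ioi 0) →
        Tendsto (fun n => ∫ t in Ioi 0, f (φ n) t i * k t) atTop
          (𝓝 (∫ t in Ioi 0, γ t i * k t))) ∧
      ∃ N : ℕ → ℕ, Tendsto N atTop atTop ∧ ∀ᵐ t ∂(volume.restrict (Ioi (0 : ℝ))),
        Tendsto (fun j => ((N j : ℝ))⁻¹ • ∑ n ∈ Finset.range (N j), f (φ n) t) atTop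
          (𝓝 (γ t)) := by
  let ν : Measure ℝ := volume.restrict (Ioi 0)
  -- The density `e^(-t)` gives a finite measure with the same null sets, so no diagonal argument
  -- over bounded intervals is needed; a test `k` becomes `e^t k`.
  let ρ : ℝ → ENNReal := fun t => ENNReal.ofReal (Real.exp (-t))
  have hρm : Measurable ρ := (Real.measurable_exp.comp measurable_neg).ennreal_ofReal
  have hρ0 : ∀ t, ρ t ≠ 0 := fun t => by simp [ρ, Real.exp_pos]
  have hρt : ∀ t, (ρ t).toReal = Real.exp (-t) := fun t =>
    ENNReal.toReal_ofReal (Real.exp_pos _).le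
  have hfin : IsFiniteMeasure (ν.withDensity ρ) :=
    isFiniteMeasure_withDensity_ofReal (integrableOn_exp_neg_Ioi 0).hasFiniteIntegral
  have hac : ν ≪ ν.withDensity ρ :=
    withDensity_absolutelyContinuous' hρm.aemeasurable (Eventually.of_forall hρ0)
  have hfC' : ∀ n, ∀ᵐ t ∂(ν.withDensity ρ), ∀ i, |f n t i| ≤ C := fun n =>
    (withDensity_absolutelyContinuous ν ρ).ae_le
      ((ae_restrict_mem measurableSet_Ioi).mono fun t ht => hfC n t ht)
  obtain ⟨φ, γ, hφ, hγm, hγb, hw, N, hN, hNae⟩ :=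
    exists_subseq_weak_cesaro (ν.withDensity ρ) f C hC hf hfC'
  refine ⟨φ, γ, hφ, hγm, hγb, fun i k hk => ?_, N, hN, hac.ae_le hNae⟩
  have hρfin : ∀ᵐ t ∂ν, ρ t < ⊤ := Eventually.of_forall fun t => ENNReal.ofReal_lt_top
  have hexp : ∀ t : ℝ, Real.exp (-t) * Real.exp t = 1 := fun t => by
    rw [← Real.exp_add]; simp
  have hk' : Integrable (fun t => Real.exp t * k t) (ν.withDensity ρ) := by
    rw [integrable_withDensity_iff_integrable_smul' hρm hρfin]
    refine hk.congr (Eventually.of_forall fun t => ?_)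
    simp only [hρt, smul_eq_mul]
    rw [← mul_assoc, hexp, one_mul]
  have key : ∀ g : ℝ → ℝ, ∫ t, g t * (Real.exp t * k t) ∂(ν.withDensity ρ)
      = ∫ t in Ioi 0, g t * k t := fun g => by
    rw [integral_withDensity_eq_integral_toReal_smul hρm hρfin]
    refine integral_congr_ae (Eventually.of_forall fun t => ?_)
    simp only [hρt, smul_eq_mul]
    linear_combination g t * k t * hexp t
  simpa only [key] using hw i _ hk'

end Compactness

/-! ### Averages, Laplacian and diffusion on the graph. -/

section GraphOperators

theorem WeightedGraph.weight_nonneg {V : Type*} (G : WeightedGraph V) (i j : V) :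
    0 ≤ G.weight i j := by
  by_cases h : G.graph.Adj i j
  · exact (G.weight_pos i j h).le
  · exact (G.weight_zero i j h).ge

variable {V : Type*} [Fintype V] (G : WeightedGraph V) (r : ℝ)

theorem WeightedGraph.deg_pos [Nontrivial V] (i : V) : 0 < G.deg i := by
  obtain ⟨j, hj⟩ := G.connected.preconnected.exists_adj_of_nontrivial i
  exact (G.weight_pos i j hj).trans_le
    (Finset.single_le_sum (fun j _ => G.weight_nonneg i j) (Finset.mem_univ j))

/-- With at least two vertices, connectedness makes degrees positive; for `r = 0` the weight is 1
even at degree zero. -/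
theorem WeightedGraph.deg_rpow_pos {r : ℝ} (hV : Nontrivial V ∨ r = 0) (i : V) :
    0 < G.deg i ^ r := by
  rcases hV with h | h
  · exact Real.rpow_pos_of_pos (G.deg_pos i) r
  · simp [h]

theorem avg_eq (u : V → ℝ) :
    avg G r u = (∑ i, u i * G.deg i ^ r) / ∑ i, G.deg i ^ r := by
  simp [avg, ip]

theorem avg_add (u v : V → ℝ) : avg G r (u + v) = avg G r u + avg G r v := by
  simp only [avg_eq, ← add_div, ← Finset.sum_add_distrib, Pi.add_apply, add_mul]

theorem avg_smul (c : ℝ) (u : V → ℝ) : avg G r (c • u) = c * avg G r u := by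
  simp only [avg_eq, ← mul_div_assoc, Finset.mul_sum, Pi.smul_apply, smul_eq_mul, mul_assoc]

/-- The average as a continuous linear functional. -/
def avgCLM : (V → ℝ) →L[ℝ] ℝ :=
  LinearMap.toContinuousLinearMap
    { toFun := avg G r, map_add' := avg_add G r, map_smul' := avg_smul G r }

@[simp] theorem avgCLM_apply (u : V → ℝ) : avgCLM G r u = avg G r u := rfl

theorem continuous_avg : Continuous (avg G r) := (avgCLM G r).continuous

theorem avg_sub (u v : V → ℝ) : avg G r (u - v) = avg G r u - avg G r v :=
  map_sub (avgCLM G r) u v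

/-- The weight `d_i^r` cancels the factor `d_i^(-r)`, leaving a double sum that is antisymmetric in
`i` and `j`. -/
theorem avg_laplacian {r : ℝ} (hV : Nontrivial V ∨ r = 0) (u : V → ℝ) :
    avg G r (laplacian G r u) = 0 := by
  rw [avg_eq, div_eq_zero_iff]
  left
  have h1 : ∀ i, laplacian G r u i * G.deg i ^ r = ∑ j, G.weight i j * (u i - u j) := fun i => by
    have h2 : G.deg i ^ (-r) * G.deg i ^ r = 1 := by
      rcases hV with h | h
      · rw [← Real.rpow_add (G.deg_pos i)]; simp
      · simp [h]
    change G.deg i ^ (-r) * (∑ j, G.weight i j * (u i - u j)) * G.deg i ^ r = _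
    linear_combination (∑ j, G.weight i j * (u i - u j)) * h2
  simp only [h1]
  have h3 : ∑ i, ∑ j, G.weight i j * (u i - u j) = -∑ i, ∑ j, G.weight i j * (u i - u j) := by
    conv_lhs => rw [Finset.sum_comm]
    simp only [← Finset.sum_neg_distrib]
    refine Finset.sum_congr rfl fun i _ => Finset.sum_congr rfl fun j _ => ?_
    rw [G.weight_symm j i]; ring
  linarith

section Positive

variable {r}
variable (hV : Nontrivial V ∨ r = 0)
include hV

theorem sum_deg_rpow_pos : 0 < ∑ i, G.deg i ^ r :=
  Finset.sum_pos (fun i _ => G.deg_rpow_pos hV i)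
    (Finset.univ_nonempty_iff.2 G.connected.nonempty)

theorem avg_one : avg G r 1 = 1 := by
  rw [avg_eq]
  simpa using div_self (sum_deg_rpow_pos G hV).ne'

theorem avg_const (c : ℝ) : avg G r (fun _ => c) = c := by
  have h : (fun _ : V => c) = c • (1 : V → ℝ) := by funext i; simp
  rw [h, avg_smul, avg_one G hV, mul_one]

theorem avg_mono {u v : V → ℝ} (h : ∀ i, u i ≤ v i) : avg G r u ≤ avg G r v := by
  rw [avg_eq, avg_eq]
  exact div_le_div_of_nonneg_right (Finset.sum_le_sum fun i _ =>
    mul_le_mul_of_nonneg_right (h i) (G.deg_rpow_pos hV i).le) (sum_deg_rpow_pos G hV).le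

theorem avg_mem_Icc {a b : ℝ} {u : V → ℝ} (h : ∀ i, u i ∈ Icc a b) : avg G r u ∈ Icc a b := by
  constructor
  · rw [← avg_const G hV a]; exact avg_mono G hV fun i => (h i).1
  · rw [← avg_const G hV b]; exact avg_mono G hV fun i => (h i).2

theorem abs_avg_le {C : ℝ} {u : V → ℝ} (h : ∀ i, |u i| ≤ C) : |avg G r u| ≤ C :=
  abs_le.2 (avg_mem_Icc G hV fun i => abs_le.1 (h i))

theorem avg_pos {u : V → ℝ} (h : ∀ i, 0 ≤ u i) (hu : u ≠ 0) : 0 < avg G r u := by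
  obtain ⟨i, hi⟩ := Function.ne_iff.1 hu
  rw [avg_eq]
  refine div_pos (Finset.sum_pos' (fun j _ => mul_nonneg (h j) (G.deg_rpow_pos hV j).le)
    ⟨i, Finset.mem_univ i, ?_⟩) (sum_deg_rpow_pos G hV)
  exact mul_pos ((h i).lt_of_ne' hi) (G.deg_rpow_pos hV i)

theorem avg_lt_one {u : V → ℝ} (h : ∀ i, u i ≤ 1) (hu : u ≠ 1) : avg G r u < 1 := by
  have h1 := avg_pos G hV (u := 1 - u) (fun i => by simpa using h i) (sub_ne_zero.2 hu.symm)
  rw [avg_sub, avg_one G hV] at h1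
  linarith

end Positive

/-- The Laplacian as a continuous linear map. -/
def laplacianCLM : (V → ℝ) →L[ℝ] (V → ℝ) := LinearMap.toContinuousLinearMap (laplacian G r)

theorem diffusion_eq (t : ℝ) :
    diffusion G r t = NormedSpace.exp (t • -laplacianCLM G r) := by
  rw [diffusion, laplacianCLM]
  congr 1
  ext u i
  simp

theorem hasDerivAt_diffusion (t : ℝ) :
    HasDerivAt (diffusion G r) (-laplacianCLM G r * diffusion G r t) t := by
  have h : diffusion G r = fun t : ℝ => NormedSpace.exp (t • -laplacianCLM G r) :=
    funext (diffusion_eq G r)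
  rw [h]
  exact hasDerivAt_exp_smul_const' (-laplacianCLM G r) t

theorem diffusion_zero : diffusion G r 0 = 1 := by
  rw [diffusion_eq, zero_smul, NormedSpace.exp_zero]

/-- The difference quotient `(e^{-tΔ} - 1) / t`, extended continuously by `-Δ` to `t = 0`. -/
def diffusionSlope (t : ℝ) : (V → ℝ) →L[ℝ] (V → ℝ) := dslope (diffusion G r) 0 t

theorem diffusionSlope_zero : diffusionSlope G r 0 = -laplacianCLM G r := by
  rw [diffusionSlope, dslope_same, (hasDerivAt_diffusion G r 0).deriv, diffusion_zero, mul_one]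

theorem continuous_diffusionSlope : Continuous (diffusionSlope G r) := by
  rw [← continuousOn_univ]
  refine (continuousOn_dslope univ_mem).2 ⟨?_, (hasDerivAt_diffusion G r 0).differentiableAt⟩
  exact fun t _ => (hasDerivAt_diffusion G r t).continuousAt.continuousWithinAt

/-- Splitting off the identity exposes the factor `τ` in the increments of the scheme. -/
theorem diffusion_apply (t : ℝ) (u : V → ℝ) (i : V) :
    diffusion G r t u i = u i + t * diffusionSlope G r t u i := by
  have h := sub_smul_dslope (diffusion G r) 0 t
  rw [sub_zero, diffusion_zero] at h
  rw [eq_add_of_sub_eq h.symm]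
  simp [diffusionSlope, add_comm]

/-- The time derivative of the average is the average of `-Δ e^(-tΔ) u`, which vanishes. -/
theorem avg_diffusion {r : ℝ} (hV : Nontrivial V ∨ r = 0) (t : ℝ) (u : V → ℝ) :
    avg G r (diffusion G r t u) = avg G r u := by
  have h1 : ∀ s, HasDerivAt (fun s => avgCLM G r (diffusion G r s u)) 0 s := fun s => by
    have h2 := (avgCLM G r).hasFDerivAt.comp_hasDerivAt s
      ((hasDerivAt_diffusion G r s).clm_apply (hasDerivAt_const s u))
    have h3 : avgCLM G r ((-laplacianCLM G r * diffusion G r s) u + diffusion G r s 0) = 0 := by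
      have := avg_laplacian G hV (diffusion G r s u)
      rw [map_zero, add_zero]
      change avgCLM G r (-laplacian G r (diffusion G r s u)) = 0
      rw [map_neg, avgCLM_apply, this, neg_zero]
    rw [h3] at h2
    exact h2
  have h4 := is_const_of_deriv_eq_zero (fun s => (h1 s).differentiableAt) (fun s => (h1 s).deriv)
    t 0
  simpa [diffusion_zero] using h4

/-- The slope is continuous up to `t = 0`, hence bounded on the compact interval; this keeps the
estimates uniform as `τ → 0`. -/
theorem exists_bound_diffusionSlope (a : ℝ) :
    ∃ B, 0 ≤ B ∧ ∀ t ∈ Icc 0 a, ∀ u : V → ℝ, (∀ i, u i ∈ Icc (0 : ℝ) 1) → ∀ i,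
      |diffusionSlope G r t u i| ≤ B := by
  obtain ⟨B, hB⟩ := isCompact_Icc.exists_bound_of_continuousOn (s := Icc (0 : ℝ) a)
    (continuous_diffusionSlope G r).continuousOn
  refine ⟨max B 0, le_max_right _ _, fun t ht u hu i => ?_⟩
  have hu1 : ‖u‖ ≤ 1 := (pi_norm_le_iff_of_nonneg zero_le_one).2 fun i => by
    rw [Real.norm_eq_abs, abs_of_nonneg (hu i).1]; exact (hu i).2
  calc _ ≤ ‖diffusionSlope G r t u‖ := norm_le_pi_norm _ i
    _ ≤ ‖diffusionSlope G r t‖ * ‖u‖ := ContinuousLinearMap.le_opNorm _ _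
    _ ≤ B * 1 := mul_le_mul (hB t ht) hu1 (norm_nonneg _) ((norm_nonneg _).trans (hB t ht))
    _ ≤ max B 0 := by rw [mul_one]; exact le_max_left _ _

end GraphOperators

/-! ### The semi-discrete scheme: solvability and uniform bounds. -/

section Scheme

variable {V : Type*} [Fintype V] (G : WeightedGraph V) {r : ℝ}

/-- If the deviation of `β ∈ 𝓑(w)` from its average is bounded above on `{w = 0}` and below on
`{w = 1}`, then `β` is bounded in terms of the average of `w`. -/
theorem abs_le_of_mem_obstacleSet (hV : Nontrivial V ∨ r = 0) {w β : V → ℝ}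
    (hβ : β ∈ obstacleSet w) {K : ℝ} (hK : 0 ≤ K)
    (h0 : ∀ i, w i = 0 → β i ≤ avg G r β + K) (h1 : ∀ i, w i = 1 → avg G r β - K ≤ β i)
    (hm0 : 0 < avg G r w) (hm1 : avg G r w < 1) (i : V) :
    |β i| ≤ K / avg G r w + K / (1 - avg G r w) := by
  set c := avg G r β
  set m := avg G r w
  have hm1' : 0 < 1 - m := by linarith
  have hA : 0 ≤ K / m := by positivity
  have hB : 0 ≤ K / (1 - m) := by positivity
  -- When `c + K` is positive, `(c + K)(1 - w)` dominates `β` at every vertex; averaging gives `c ≤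
  -- (c + K)(1 - m)`.
  have hc0 : c + K ≤ K / m := by
    rcases le_or_gt (c + K) 0 with h | h
    · exact h.trans hA
    have h2 : c ≤ avg G r ((c + K) • (1 - w)) := by
      refine avg_mono G hV fun j => ?_
      obtain ⟨hj, ha, hb, hd⟩ := hβ j
      simp only [Pi.smul_apply, Pi.sub_apply, Pi.one_apply, smul_eq_mul]
      rcases eq_or_lt_of_le hj.1 with e | e
      · rw [← e]; linarith [h0 j e.symm]
      rcases eq_or_lt_of_le hj.2 with e' | e'
      · rw [e']; linarith [hd e']
      · rw [hb ⟨e, e'⟩]; exact mul_nonneg h.le (by linarith)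
    rw [avg_smul, avg_sub, avg_one G hV] at h2
    rw [le_div_iff₀ hm0]
    linarith
  -- The mirror image under `w ↦ 1 - w`, `β ↦ -β`.
  have hc1 : K - c ≤ K / (1 - m) := by
    rcases le_or_gt (K - c) 0 with h | h
    · exact h.trans hB
    have h2 : avg G r ((c - K) • w) ≤ c := by
      refine avg_mono G hV fun j => ?_
      obtain ⟨hj, ha, hb, hd⟩ := hβ j
      simp only [Pi.smul_apply, smul_eq_mul]
      rcases eq_or_lt_of_le hj.1 with e | e
      · rw [← e]; linarith [ha e.symm]
      rcases eq_or_lt_of_le hj.2 with e' | e'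
      · rw [e']; linarith [h1 j e']
      · rw [hb ⟨e, e'⟩]; exact mul_nonpos_of_nonpos_of_nonneg (by linarith) hj.1
    rw [avg_smul] at h2
    rw [le_div_iff₀ hm1']
    linarith
  obtain ⟨hj, ha, hb, hd⟩ := hβ i
  rcases eq_or_lt_of_le hj.1 with e | e
  · rw [abs_of_nonneg (ha e.symm)]; linarith [h0 i e.symm]
  rcases eq_or_lt_of_le hj.2 with e' | e'
  · rw [abs_of_nonpos (hd e')]; linarith [h1 i e']
  · rw [hb ⟨e, e'⟩, abs_zero]; positivity

/-- Solvability of one step of the semi-discrete scheme. -/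
theorem exists_scheme_step (hV : Nontrivial V ∨ r = 0) {l : ℝ} (hl0 : 0 < l) (hl1 : l < 1)
    (v : V → ℝ) (hv : avg G r v ∈ Icc (0 : ℝ) 1) :
    ∃ w β : V → ℝ, (∀ i, w i - v i - l * w i + l * avg G r w = l * β i - l * avg G r β) ∧
      β ∈ obstacleSet w := by
  have hl : 0 < 1 - l := by linarith
  -- The equation reads `(1 - l) w = v + c + l β` with the unknown scalar `c = -l (avg w + avg β)`.
  -- For given `c`, clipping solves it together with the inclusion; `c` is consistent exactly when
  -- `avg w = avg v`, which the intermediate value theorem achieves.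
  let w : ℝ → V → ℝ := fun c i => max 0 (min 1 ((v i + c) / (1 - l)))
  have hcont : Continuous fun c => avg G r (w c) := by
    refine (continuous_avg G r).comp (continuous_pi fun i => ?_)
    fun_prop
  have hvn : ∀ i, |v i| ≤ ‖v‖ := norm_le_pi_norm v
  have hlo : avg G r (w (-‖v‖)) = 0 := by
    have : w (-‖v‖) = fun _ => 0 := by
      funext i
      refine max_eq_left ((min_le_right _ _).trans (div_nonpos_of_nonpos_of_nonneg ?_ hl.le))
      linarith [(abs_le.1 (hvn i)).2]
    rw [this, avg_const G hV]
  have hhi : avg G r (w (‖v‖ + 1)) = 1 := by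
    have : w (‖v‖ + 1) = fun _ => 1 := by
      funext i
      have h1 : 1 ≤ (v i + (‖v‖ + 1)) / (1 - l) := by
        rw [le_div_iff₀ hl]
        linarith [(abs_le.1 (hvn i)).1]
      simp only [w]
      rw [min_eq_left h1, max_eq_right zero_le_one]
    rw [this, avg_const G hV]
  obtain ⟨c, -, hc⟩ := intermediate_value_Icc (show -‖v‖ ≤ ‖v‖ + 1 by linarith [norm_nonneg v])
    hcont.continuousOn (show avg G r v ∈ Icc _ _ by rw [hlo, hhi]; exact hv)
  let β : V → ℝ := l⁻¹ • ((1 - l) • w c - v - fun _ => c)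
  have hβ : ∀ i, l * β i = (1 - l) * w c i - v i - c := fun i => by
    simp only [β, Pi.smul_apply, Pi.sub_apply, smul_eq_mul]
    rw [← mul_assoc, mul_inv_cancel₀ hl0.ne', one_mul]
  have hβavg : l * avg G r β = (1 - l) * avg G r (w c) - avg G r v - c := by
    simp only [β]
    rw [avg_smul, avg_sub, avg_sub, avg_smul, avg_const G hV, ← mul_assoc,
      mul_inv_cancel₀ hl0.ne', one_mul]
  refine ⟨w c, β, fun i => ?_, fun i => ⟨⟨le_max_left _ _, max_le zero_le_one (min_le_left _ _)⟩,
    fun h => ?_, fun h => ?_, fun h => ?_⟩⟩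
  · rw [hβ, hβavg]
    simp only at hc
    rw [hc]; ring
  · have h1 : min 1 ((v i + c) / (1 - l)) ≤ 0 := max_eq_left_iff.1 h
    have h2 : (v i + c) / (1 - l) ≤ 0 := by
      rcases min_le_iff.1 h1 with h' | h'
      · linarith
      · exact h'
    rw [div_le_iff₀ hl] at h2
    have h3 := hβ i
    rw [h] at h3
    exact nonneg_of_mul_nonneg_right (by linarith) hl0
  · have h1 : w c i = (v i + c) / (1 - l) := by
      rcases max_choice 0 (min 1 ((v i + c) / (1 - l))) with h' | h'
      · exact absurd h' h.1.ne'
      rcases min_choice 1 ((v i + c) / (1 - l)) with h'' | h''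
      · exact absurd (h'.trans h'') h.2.ne
      · exact h'.trans h''
    have h3 := hβ i
    rw [h1, mul_div_cancel₀ _ hl.ne'] at h3
    have h4 : l * β i = 0 := by linarith
    exact (mul_eq_zero.1 h4).resolve_left hl0.ne'
  · have h2 : 1 ≤ (v i + c) / (1 - l) := by
      by_contra h'
      push Not at h'
      have : w c i < 1 := max_lt zero_lt_one (min_lt_of_right_lt h')
      linarith
    rw [le_div_iff₀ hl] at h2
    have h3 := hβ i
    rw [h] at h3
    exact nonpos_of_mul_nonpos_right (by linarith) hl0

/-- The semi-discrete scheme is solvable for time steps below `ε`. -/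
theorem exists_isSemiDiscrete (hV : Nontrivial V ∨ r = 0) {ε τ : ℝ} (hτ : 0 < τ) (hτε : τ < ε)
    (u₀ : V → ℝ) (hu₀ : ∀ i, u₀ i ∈ Icc (0 : ℝ) 1) :
    ∃ u β : ℕ → V → ℝ, IsSemiDiscrete G r ε τ u₀ u β := by
  have hε : 0 < ε := hτ.trans hτε
  have step : ∀ v : {v : V → ℝ // ∀ i, v i ∈ Icc (0 : ℝ) 1}, ∃ w β : V → ℝ,
      (∀ i, w i - diffusion G r τ v i - τ / ε * w i + τ / ε * avg G r w
        = τ / ε * β i - τ / ε * avg G r β) ∧ β ∈ obstacleSet w := fun v =>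
    exists_scheme_step G hV (by positivity) ((div_lt_one hε).2 hτε) _ (by
      rw [avg_diffusion G hV]; exact avg_mem_Icc G hV v.2)
  choose w b h1 h2 using step
  let u : ℕ → {v : V → ℝ // ∀ i, v i ∈ Icc (0 : ℝ) 1} := fun m =>
    Nat.rec ⟨u₀, hu₀⟩ (fun _ v => ⟨w v, fun i => (h2 v i).1⟩) m
  -- The multiplier with index `m + 1` belongs to the step from `u m`; the value at index 0 is
  -- irrelevant.
  exact ⟨fun m => (u m).1, fun m => b (u (m - 1)), rfl, fun m => ⟨h1 (u m), h2 (u m)⟩⟩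

namespace IsSemiDiscrete

variable {G} {ε τ : ℝ} {u₀ : V → ℝ} {u β : ℕ → V → ℝ}

theorem mem_Icc (h : IsSemiDiscrete G r ε τ u₀ u β) (hu₀ : ∀ i, u₀ i ∈ Icc (0 : ℝ) 1) (m : ℕ)
    (i : V) : u m i ∈ Icc (0 : ℝ) 1 := by
  cases m with
  | zero => rw [h.1]; exact hu₀ i
  | succ m => exact ((h.2 m).2 i).1

/-- Both `λ`-terms are mean-free and diffusion preserves the mean. -/
theorem avg_eq (h : IsSemiDiscrete G r ε τ u₀ u β) (hV : Nontrivial V ∨ r = 0) (m : ℕ) :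
    avg G r (u m) = avg G r u₀ := by
  induction m with
  | zero => rw [h.1]
  | succ m ih =>
    have h1 : u (m + 1) - diffusion G r τ (u m) - (τ / ε) • u (m + 1)
        + (fun _ => τ / ε * avg G r (u (m + 1)))
        = (τ / ε) • β (m + 1) - fun _ => τ / ε * avg G r (β (m + 1)) := by
      funext i
      simpa using (h.2 m).1 i
    have h2 := congrArg (avg G r) h1
    simp only [avg_add, avg_sub, avg_smul, avg_const G hV, avg_diffusion G hV] at h2
    linarith

/-- The increments of the scheme. -/
theorem sub_eq (h : IsSemiDiscrete G r ε τ u₀ u β) (m : ℕ) (i : V) :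
    u (m + 1) i - u m i = τ * (diffusionSlope G r τ (u m) i
      + ε⁻¹ * (u (m + 1) i - avg G r (u (m + 1)) + β (m + 1) i - avg G r (β (m + 1)))) := by
  have h1 := (h.2 m).1 i
  rw [diffusion_apply] at h1
  rw [div_eq_mul_inv] at h1
  linear_combination h1

end IsSemiDiscrete

/-- Uniform bounds on the multipliers and the increments of the scheme. -/
theorem exists_bound_isSemiDiscrete (hV : Nontrivial V ∨ r = 0) {ε : ℝ} (hε : 0 < ε)
    (u₀ : V → ℝ) (hu₀ : ∀ i, u₀ i ∈ Icc (0 : ℝ) 1) (h0 : u₀ ≠ 0) (h1 : u₀ ≠ 1) :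
    ∃ C L : ℝ, 0 ≤ C ∧ 0 ≤ L ∧ ∀ (τ : ℝ) (u β : ℕ → V → ℝ), 0 < τ → τ < ε →
      IsSemiDiscrete G r ε τ u₀ u β →
      (∀ m i, |β (m + 1) i| ≤ C) ∧ ∀ m i, |u (m + 1) i - u m i| ≤ τ * L := by
  obtain ⟨B, hB0, hB⟩ := exists_bound_diffusionSlope G r ε
  have hm0 : 0 < avg G r u₀ := avg_pos G hV (fun i => (hu₀ i).1) h0
  have hm1 : avg G r u₀ < 1 := avg_lt_one G hV (fun i => (hu₀ i).2) h1
  have hm1' : 0 < 1 - avg G r u₀ := by linarith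
  -- The diffusion slope contributes at most `ε B`, and the state minus its mean at most 1.
  let K := ε * B + 1
  have hK : 0 ≤ K := by positivity
  let C := K / avg G r u₀ + K / (1 - avg G r u₀)
  have hC : 0 ≤ C := by positivity
  refine ⟨C, B + ε⁻¹ * (2 + 2 * C), hC, by positivity, fun τ u β hτ hτε h => ?_⟩
  have hS : ∀ m i, |diffusionSlope G r τ (u m) i| ≤ B := fun m i =>
    hB τ ⟨hτ.le, hτε.le⟩ _ (h.mem_Icc hu₀ m) i
  have hβ : ∀ m i, |β (m + 1) i| ≤ C := by
    intro m i
    have hmass := h.avg_eq hV (m + 1)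
    -- The singular factor `ε/τ` multiplies an increment that is nonpositive where the new state is
    -- 0 and nonnegative where it is 1, so it can be dropped from each one-sided bound.
    have hdev : ∀ j, β (m + 1) j - avg G r (β (m + 1)) = ε * τ⁻¹ * (u (m + 1) j - u m j)
        - ε * diffusionSlope G r τ (u m) j - u (m + 1) j + avg G r u₀ := fun j => by
      rw [h.sub_eq m j, hmass]
      field_simp
      ring
    have hετ : 0 ≤ ε * τ⁻¹ := by positivity
    have hSε : ∀ j, |ε * diffusionSlope G r τ (u m) j| ≤ ε * B := fun j => by
      rw [abs_mul, abs_of_pos hε]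
      exact mul_le_mul_of_nonneg_left (hS m j) hε.le
    have := abs_le_of_mem_obstacleSet G hV (h.2 m).2 hK (fun j hj => ?_) (fun j hj => ?_)
      (hmass ▸ hm0) (hmass ▸ hm1) i
    · rwa [hmass] at this
    · have h2 := hdev j
      rw [hj] at h2
      have h3 := mul_nonneg hετ (h.mem_Icc hu₀ m j).1
      linarith [(abs_le.1 (hSε j)).1]
    · have h2 := hdev j
      rw [hj] at h2
      have h3 := mul_nonneg hετ (sub_nonneg.2 (h.mem_Icc hu₀ m j).2)
      linarith [(abs_le.1 (hSε j)).2]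
  refine ⟨hβ, fun m i => ?_⟩
  rw [h.sub_eq m i, abs_mul, abs_of_pos hτ]
  refine mul_le_mul_of_nonneg_left ((abs_add_le _ _).trans (add_le_add (hS m i) ?_)) hτ.le
  rw [abs_mul, abs_of_pos (inv_pos.2 hε)]
  refine mul_le_mul_of_nonneg_left ?_ (inv_pos.2 hε).le
  have h2 := h.mem_Icc hu₀ (m + 1) i
  have h3 := avg_mem_Icc G hV (h.mem_Icc hu₀ (m + 1))
  have h4 := abs_le.1 (hβ m i)
  have h5 := abs_le.1 (abs_avg_le G hV (hβ m))
  rw [abs_le]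
  constructor <;> linarith [h2.1, h2.2, h3.1, h3.2, h4.1, h4.2, h5.1, h5.2]

end Scheme

/-! ### Weak derivatives of primitives. -/

section WeakDerivative

variable {V : Type*} [Fintype V] (G : WeightedGraph V) (r : ℝ)

theorem pairing_eq_sum {a b : ℝ} {u v : ℝ → V → ℝ}
    (h : ∀ i, IntegrableOn (fun t => u t i * v t i) (Ioo a b)) :
    pairing G r a b u v = ∑ i, G.deg i ^ r * ∫ t in Ioo a b, u t i * v t i := by
  unfold pairing ip
  rw [integral_finsetSum _ fun i _ => (h i).mul_const _]
  refine Finset.sum_congr rfl fun i _ => ?_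
  rw [integral_mul_const, mul_comm]

theorem memLpOn_of_continuous {u : ℝ → V → ℝ} (hu : Continuous u) (p : ENNReal) (a b : ℝ) :
    MemLpOn p a b u := by
  obtain ⟨C, hC⟩ := isCompact_Icc.exists_bound_of_continuousOn (s := Icc a b) hu.continuousOn
  exact MemLp.of_bound hu.aestronglyMeasurable C
    ((ae_restrict_mem measurableSet_Ioo).mono fun t ht => hC t (Ioo_subset_Icc_self ht))

theorem memLpOn_of_bound {u : ℝ → V → ℝ} (hu : Measurable u) {C : ℝ} {a b : ℝ}
    (h : ∀ t ∈ Ioo a b, ∀ i, |u t i| ≤ C) (p : ENNReal) : MemLpOn p a b u := by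
  refine MemLp.of_bound hu.aestronglyMeasurable (max C 0)
    ((ae_restrict_mem measurableSet_Ioo).mono fun t ht => ?_)
  exact (pi_norm_le_iff_of_nonneg (le_max_right _ _)).2 fun i => (h t ht i).trans (le_max_left _ _)

theorem intervalIntegrable_of_locallyIntegrable {F : ℝ → ℝ} (hF : LocallyIntegrable F) (x y : ℝ) :
    IntervalIntegrable F volume x y :=
  intervalIntegrable_iff.2 ((hF.integrableOn_isCompact isCompact_uIcc).mono_set uIoc_subset_uIcc)

/-- Integration by parts of a primitive of a locally integrable function against a test function. -/
theorem integral_primitive_mul_deriv {F : ℝ → ℝ} (hF : LocallyIntegrable F) (c : ℝ) {φ : ℝ → ℝ}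
    (hφ : ContDiff ℝ ∞ φ) {a b : ℝ} (hab : a ≤ b) (ha : φ a = 0) (hb : φ b = 0) :
    ∫ t in Ioo a b, (c + ∫ s in (0 : ℝ)..t, F s) * deriv φ t = -∫ t in Ioo a b, F t * φ t := by
  have hFi : ∀ x y, IntervalIntegrable F volume x y := fun x y => intervalIntegrable_of_locallyIntegrable hF x y
  have hUd : ∀ᵐ t, HasDerivAt (fun t => c + ∫ s in (0 : ℝ)..t, F s) (F t) t := by
    filter_upwards [_root_.LocallyIntegrable.ae_hasDerivAt_integral hF] with t ht
    exact (ht 0).const_add c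
  have hUac : AbsolutelyContinuousOnInterval (fun t => c + ∫ s in (0 : ℝ)..t, F s) a b := by
    have h1 : AbsolutelyContinuousOnInterval (fun t => ∫ s in a..t, F s) a b :=
      (hFi a b).absolutelyContinuousOnInterval_intervalIntegral left_mem_uIcc
    have h2 : AbsolutelyContinuousOnInterval (fun _ : ℝ => c + ∫ s in (0 : ℝ)..a, F s) a b :=
      (LipschitzWith.const _).lipschitzOnWith.absolutelyContinuousOnInterval
    have h3 : (fun t => c + ∫ s in (0 : ℝ)..t, F s)
        = (fun _ : ℝ => c + ∫ s in (0 : ℝ)..a, F s) + fun t => ∫ s in a..t, F s := by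
      funext t
      rw [Pi.add_apply, add_assoc,
        intervalIntegral.integral_add_adjacent_intervals (hFi 0 a) (hFi a t)]
    rw [h3]
    exact h2.add h1
  have hφac : AbsolutelyContinuousOnInterval φ a b :=
    (hφ.of_le (by exact_mod_cast le_top)).contDiffOn.absolutelyContinuousOnInterval
  have h := hUac.integral_mul_deriv_eq_deriv_mul hφac
  rw [ha, hb, mul_zero, mul_zero, sub_zero, zero_sub] at h
  rw [← integral_Ioc_eq_integral_Ioo, ← integral_Ioc_eq_integral_Ioo,
    ← intervalIntegral.integral_of_le hab, ← intervalIntegral.integral_of_le hab, h]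
  congr 1
  refine intervalIntegral.integral_congr_ae ?_
  filter_upwards [hUd] with t ht _
  rw [ht.deriv]

/-- A primitive of a bounded function is continuous and has that function as weak derivative. -/
theorem hasWeakDerivLoc_of_primitive {U F : ℝ → V → ℝ} {L : ℝ} (hF : Measurable F)
    (hFL : ∀ t i, |F t i| ≤ L) (u₀ : V → ℝ)
    (hU : ∀ t, 0 ≤ t → ∀ i, U t i = u₀ i + ∫ s in (0 : ℝ)..t, F s i) :
    ContinuousOn U (Ici 0) ∧ HasWeakDerivLoc G r (Ici 0) U F := by
  have hFl : ∀ i, LocallyIntegrable (fun t => F t i) := fun i =>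
    (locallyIntegrable_const L).mono
      ((measurable_pi_apply i).comp hF).aestronglyMeasurable
      (Eventually.of_forall fun t => by
        rw [Real.norm_eq_abs, Real.norm_eq_abs]; exact (hFL t i).trans (le_abs_self L))
  -- `U` is prescribed only for `t ≥ 0`; `W` agrees with it there and is continuous on the whole
  -- line.
  let W : ℝ → V → ℝ := fun t i => u₀ i + ∫ s in (0 : ℝ)..t, F s i
  have hWc : Continuous W := continuous_pi fun i => continuous_const.add
    (intervalIntegral.continuous_primitive (fun x y => intervalIntegrable_of_locallyIntegrable (hFl i) x y) 0)
  have hUW : ∀ t, 0 ≤ t → U t = W t := fun t ht => funext fun i => hU t ht i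
  refine ⟨hWc.continuousOn.congr fun t ht => hUW t ht, fun a ha b _ => ?_⟩
  have hIoo : ∀ t ∈ Ioo a b, U t = W t := fun t ht => hUW t ((mem_Ici.1 ha).trans ht.1.le)
  refine ⟨(memLpOn_of_continuous hWc 2 a b).ae_eq ?_, memLpOn_of_bound hF (fun t _ => hFL t) 2,
    fun φ hφ _ hsupp => ?_⟩
  · exact (ae_restrict_mem measurableSet_Ioo).mono fun t ht => (hIoo t ht).symm
  have hpair : pairing G r a b U (deriv φ) = pairing G r a b W (deriv φ) :=
    setIntegral_congr_fun measurableSet_Ioo fun t ht => by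
      simp only [hIoo t ht]
  rw [hpair]
  rcases le_or_gt b a with hab | hab
  · simp [pairing, Ioo_eq_empty_of_le hab]
  have hφc : Continuous φ := hφ.continuous
  have hφ' : Continuous (deriv φ) := hφ.continuous_deriv (by simp)
  rw [pairing_eq_sum, pairing_eq_sum, ← Finset.sum_neg_distrib]
  · refine Finset.sum_congr rfl fun i _ => ?_
    rw [← mul_neg]
    congr 1
    have hφi : ContDiff ℝ ∞ fun t => φ t i := (contDiff_pi.1 hφ) i
    have hz : ∀ t, t ∉ Ioo a b → φ t i = 0 := fun t ht => by
      rw [image_eq_zero_of_notMem_tsupport fun h => ht (hsupp h)]; rfl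
    have hd : ∀ t, deriv φ t i = deriv (fun t => φ t i) t := fun t => by
      rw [deriv_pi fun j => ((contDiff_pi.1 hφ j).differentiable (by simp)).differentiableAt]
    simp only [hd]
    exact integral_primitive_mul_deriv (hFl i) (u₀ i) hφi hab.le (hz a (by simp)) (hz b (by simp))
  · intro i
    refine (((hFl i).integrableOn_isCompact isCompact_Icc).mul_continuousOn
      (((continuous_apply i).comp hφc).continuousOn) isCompact_Icc).mono_set Ioo_subset_Icc_self
  · intro i
    exact ((((continuous_apply i).comp hWc).mul ((continuous_apply i).comp
      hφ')).continuousOn.integrableOn_Icc (a := a) (b := b)).mono_set Ioo_subset_Icc_self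

end WeakDerivative

/-! ### Step functions in time and pointwise compactness. -/

section StepFunctions

theorem measurable_step {α : Type*} [MeasurableSpace α] (g : ℕ → α) (τ : ℝ) :
    Measurable fun t : ℝ => g ⌈t / τ⌉₊ :=
  (measurable_from_nat (f := g)).comp (Nat.measurable_ceil.comp (measurable_id.div_const τ))

/-- The integral of a step function over a multiple of the step width. -/
theorem integral_step (g : ℕ → ℝ) {τ : ℝ} (hτ : 0 < τ) (m : ℕ) :
    ∫ s in (0 : ℝ)..(m * τ), g ⌈s / τ⌉₊ = τ * ∑ k ∈ Finset.range m, g (k + 1) := by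
  have hle : ∀ k : ℕ, (k : ℝ) * τ ≤ ((k + 1 : ℕ) : ℝ) * τ := fun k => by push_cast; nlinarith
  have hc : ∀ k : ℕ, EqOn (fun s : ℝ => g ⌈s / τ⌉₊) (fun _ => g (k + 1))
      (Ioc ((k : ℝ) * τ) (((k + 1 : ℕ) : ℝ) * τ)) := fun k s hs => by
    have h : ⌈s / τ⌉₊ = k + 1 := by
      rw [Nat.ceil_eq_iff (by omega)]
      exact ⟨by simpa using (lt_div_iff₀ hτ).2 hs.1, (div_le_iff₀ hτ).2 hs.2⟩
    simp only [h]
  have hi : ∀ k : ℕ, IntervalIntegrable (fun s : ℝ => g ⌈s / τ⌉₊) volume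
      ((k : ℝ) * τ) (((k + 1 : ℕ) : ℝ) * τ) := fun k => by
    rw [intervalIntegrable_iff_integrableOn_Ioc_of_le (hle k)]
    exact IntegrableOn.congr_fun (integrableOn_const (by simp)) (hc k).symm measurableSet_Ioc
  have h := intervalIntegral.sum_integral_adjacent_intervals (n := m) fun k _ => hi k
  rw [Nat.cast_zero, zero_mul] at h
  rw [← h, Finset.mul_sum]
  refine Finset.sum_congr rfl fun k _ => ?_
  rw [intervalIntegral.integral_of_le (hle k), setIntegral_congr_fun measurableSet_Ioc (hc k),
    ← intervalIntegral.integral_of_le (hle k), intervalIntegral.integral_const, smul_eq_mul]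
  push_cast
  ring

/-- Sequences with small increments give almost Lipschitz step functions. -/
theorem abs_step_sub_le {x : ℕ → ℝ} {τ L : ℝ} (hτ : 0 < τ) (hL : 0 ≤ L)
    (hx : ∀ m, |x (m + 1) - x m| ≤ τ * L) {s t : ℝ} (hs : 0 ≤ s) (ht : 0 ≤ t) :
    |x ⌈s / τ⌉₊ - x ⌈t / τ⌉₊| ≤ L * (|s - t| + τ) := by
  wlog hst : t ≤ s generalizing s t
  · rw [abs_sub_comm, abs_sub_comm s t]
    exact this ht hs (le_of_not_ge hst)
  have key : ∀ m k : ℕ, |x (m + k) - x m| ≤ k * (τ * L) := fun m k => by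
    induction k with
    | zero => simp
    | succ k ih =>
      rw [← add_assoc]
      calc _ ≤ |x (m + k + 1) - x (m + k)| + |x (m + k) - x m| := abs_sub_le _ _ _
        _ ≤ τ * L + k * (τ * L) := add_le_add (hx _) ih
        _ = _ := by push_cast; ring
  have hmono : ⌈t / τ⌉₊ ≤ ⌈s / τ⌉₊ := Nat.ceil_mono (by gcongr)
  obtain ⟨k, hk⟩ := Nat.exists_eq_add_of_le hmono
  rw [hk]
  refine (key _ k).trans ?_
  have h1 : (⌈s / τ⌉₊ : ℝ) < s / τ + 1 := Nat.ceil_lt_add_one (by positivity)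
  have h2 : t / τ ≤ ⌈t / τ⌉₊ := Nat.le_ceil _
  rw [hk] at h1
  push_cast at h1
  -- Rounding costs at most one extra step, the source of the additional `τ` in the bound.
  have h3 : (k : ℝ) ≤ s / τ - t / τ + 1 := by linarith
  calc (k : ℝ) * (τ * L) ≤ (s / τ - t / τ + 1) * (τ * L) := by gcongr
    _ = L * (s - t + τ) := by field_simp
    _ = _ := by rw [abs_of_nonneg (sub_nonneg.2 hst)]

/-- A pointwise compactness principle for uniformly bounded, asymptotically equicontinuous
functions on the half-line. -/
theorem exists_subseq_tendsto_pointwise {V : Type*} [Fintype V] (x : ℕ → ℝ → V → ℝ) (L : ℝ)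
    (δ : ℕ → ℝ) (hδ : Tendsto δ atTop (𝓝 0)) (hL : 0 ≤ L)
    (hb : ∀ n t, 0 ≤ t → ∀ i, x n t i ∈ Icc (0 : ℝ) 1)
    (hx : ∀ n s t, 0 ≤ s → 0 ≤ t → ∀ i, |x n s i - x n t i| ≤ L * (|s - t| + δ n)) :
    ∃ (φ : ℕ → ℕ) (y : ℝ → V → ℝ), StrictMono φ ∧
      ∀ t, 0 ≤ t → Tendsto (fun n => x (φ n) t) atTop (𝓝 (y t)) := by
  -- Compactness of a countable product of unit intervals replaces the diagonal argument; `|q|`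
  -- keeps the sampled times nonnegative.
  obtain ⟨a, -, φ, hφ, ha⟩ := (isCompact_Icc (a := (0 : ℚ → V → ℝ)) (b := 1)).tendsto_subseq
    (x := fun n (q : ℚ) => x n |(q : ℝ)|)
    (fun n => ⟨fun q i => (hb n _ (abs_nonneg _) i).1, fun q i => (hb n _ (abs_nonneg _) i).2⟩)
  have hq : ∀ (q : ℚ) (i : V), CauchySeq fun n => x (φ n) |(q : ℝ)| i := fun q i =>
    (tendsto_pi_nhds.1 (tendsto_pi_nhds.1 ha q) i).cauchySeq
  have hc : ∀ t, 0 ≤ t → ∀ i, CauchySeq fun n => x (φ n) t i := by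
    intro t ht i
    rw [Metric.cauchySeq_iff]
    intro e he
    -- The distance to `q` and the defect `δ` each cost at most `e/6`; `L + 1` avoids division by
    -- zero.
    obtain ⟨q, hq1, hq2⟩ := exists_rat_btwn (show t < t + e / (6 * (L + 1)) by
      linarith [show 0 < e / (6 * (L + 1)) by positivity])
    have hq0 : |(q : ℝ)| = q := abs_of_nonneg (ht.trans hq1.le)
    obtain ⟨n₁, hn₁⟩ := Metric.cauchySeq_iff.1 (hq q i) (e / 3) (by positivity)
    obtain ⟨n₂, hn₂⟩ := eventually_atTop.1 ((hδ.comp hφ.tendsto_atTop).eventually_lt_const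
      (show 0 < e / (6 * (L + 1)) by positivity))
    have hclose : ∀ n ≥ n₂, |x (φ n) t i - x (φ n) |(q : ℝ)| i| ≤ e / 3 := fun n hn => by
      refine (hx _ _ _ ht (abs_nonneg _) i).trans ?_
      have h1 : abs (t - |(q : ℝ)|) ≤ e / (6 * (L + 1)) := by
        rw [hq0, abs_sub_comm, abs_of_nonneg (by linarith)]; linarith
      have h2 := hn₂ n hn
      simp only [Function.comp_apply] at h2
      calc _ ≤ L * (e / (6 * (L + 1)) + e / (6 * (L + 1))) := by gcongr
        _ ≤ (L + 1) * (e / (6 * (L + 1)) + e / (6 * (L + 1))) := by gcongr; linarith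
        _ = e / 3 := by field_simp; ring
    refine ⟨max n₁ n₂, fun m hm n hn => ?_⟩
    have h1 := hclose m (le_trans (le_max_right _ _) hm)
    have h2 := hclose n (le_trans (le_max_right _ _) hn)
    have h3 := hn₁ m (le_trans (le_max_left _ _) hm) n (le_trans (le_max_left _ _) hn)
    rw [Real.dist_eq, abs_lt] at h3 ⊢
    rw [abs_le] at h1 h2
    constructor <;> linarith [h1.1, h1.2, h2.1, h2.2, h3.1, h3.2]
  have hex : ∀ t i, ∃ l, 0 ≤ t → Tendsto (fun n => x (φ n) t i) atTop (𝓝 l) := fun t i => by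
    by_cases ht : 0 ≤ t
    · obtain ⟨l, hl⟩ := cauchySeq_tendsto_of_complete (hc t ht i)
      exact ⟨l, fun _ => hl⟩
    · exact ⟨0, fun h => absurd h ht⟩
  choose y hy using hex
  exact ⟨φ, y, hφ, fun t ht => tendsto_pi_nhds.2 fun i => hy t i ht⟩

end StepFunctions

/-! ### Closure of the obstacle condition under means. -/

section ObstacleLimit

/-- The finitely many exceptional terms contribute at most a fixed `S`, and `S / N k → 0`. -/
theorem le_zero_of_tendsto_mean {x : ℕ → ℝ} (hx : ∀ᶠ n in atTop, x n ≤ 0) {N : ℕ → ℕ}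
    (hN : Tendsto N atTop atTop) {l : ℝ}
    (hl : Tendsto (fun k => ((N k : ℝ))⁻¹ * ∑ n ∈ Finset.range (N k), x n) atTop (𝓝 l)) :
    l ≤ 0 := by
  obtain ⟨n₀, hn₀⟩ := eventually_atTop.1 hx
  let S := ∑ n ∈ Finset.range n₀, |x n|
  have hS : ∀ m, ∑ n ∈ Finset.range m, x n ≤ S := fun m => by
    calc _ ≤ ∑ n ∈ Finset.range m, if n < n₀ then |x n| else 0 := by
          refine Finset.sum_le_sum fun n _ => ?_
          split_ifs with h
          · exact le_abs_self _
          · exact hn₀ n (not_lt.1 h)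
      _ = ∑ n ∈ (Finset.range m).filter (· < n₀), |x n| := (Finset.sum_filter _ _).symm
      _ ≤ S := Finset.sum_le_sum_of_subset_of_nonneg
          (fun n hn => Finset.mem_range.2 (Finset.mem_filter.1 hn).2) fun _ _ _ => abs_nonneg _
  have h0 : Tendsto (fun k => ((N k : ℝ))⁻¹ * S) atTop (𝓝 0) := by
    simpa using (tendsto_inv_atTop_nhds_zero_nat.comp hN).mul_const S
  exact le_of_tendsto_of_tendsto' hl h0 fun k =>
    mul_le_mul_of_nonneg_left (hS _) (by positivity)

/-- The graph of `𝓑` is closed under convergence of arithmetic means. -/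
theorem mem_obstacleSet_of_tendsto_mean {V : Type*} {w b : ℕ → V → ℝ} {w' b' : V → ℝ}
    (hb : ∀ n, b n ∈ obstacleSet (w n)) (hw : Tendsto w atTop (𝓝 w')) {N : ℕ → ℕ}
    (hN : Tendsto N atTop atTop)
    (hl : Tendsto (fun k => ((N k : ℝ))⁻¹ • ∑ n ∈ Finset.range (N k), b n) atTop (𝓝 b')) :
    b' ∈ obstacleSet w' := by
  intro i
  have hwi := tendsto_pi_nhds.1 hw i
  have hli : Tendsto (fun k => ((N k : ℝ))⁻¹ * ∑ n ∈ Finset.range (N k), b n i) atTop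
      (𝓝 (b' i)) := by
    simpa using tendsto_pi_nhds.1 hl i
  -- A positive limit makes `w n i` eventually positive, which excludes positive multipliers from
  -- then on.
  have hle : 0 < w' i → b' i ≤ 0 := fun h => by
    refine le_zero_of_tendsto_mean ?_ hN hli
    filter_upwards [hwi.eventually_const_lt h] with n hn
    obtain ⟨h1, -, h2, h3⟩ := hb n i
    rcases eq_or_lt_of_le h1.2 with e | e
    · exact h3 e
    · exact (h2 ⟨hn, e⟩).le
  have hge : w' i < 1 → 0 ≤ b' i := fun h => by
    have hneg : Tendsto (fun k => ((N k : ℝ))⁻¹ * ∑ n ∈ Finset.range (N k), -b n i) atTop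
        (𝓝 (-b' i)) := by
      simpa using hli.neg
    refine neg_nonpos.1 (le_zero_of_tendsto_mean ?_ hN hneg)
    filter_upwards [hwi.eventually_lt_const h] with n hn
    obtain ⟨h1, h2, h3, -⟩ := hb n i
    rw [neg_nonpos]
    rcases eq_or_lt_of_le h1.1 with e | e
    · exact h2 e.symm
    · exact (h3 ⟨e, hn⟩).ge
  refine ⟨isClosed_Icc.mem_of_tendsto hwi (Eventually.of_forall fun n => (hb n i).1),
    fun h => hge (by linarith), fun h => le_antisymm (hle h.1) (hge h.2), fun h =>
      hle (by linarith)⟩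

end ObstacleLimit

/-! ### Weak convergence on the half-line. -/

section WeakConvergence

variable {V : Type*}

/-- Convergence of vertex functions on the half-line, tested against integrable functions. -/
def TendstoWeakly (f : ℕ → ℝ → V → ℝ) (γ : ℝ → V → ℝ) : Prop :=
  ∀ i (k : ℝ → ℝ), IntegrableOn k (Ioi 0) →
    Tendsto (fun n => ∫ t in Ioi 0, f n t i * k t) atTop (𝓝 (∫ t in Ioi 0, γ t i * k t))

theorem TendstoWeakly.tendsto_setIntegral {f : ℕ → ℝ → V → ℝ} {γ : ℝ → V → ℝ}
    (h : TendstoWeakly f γ) {a b : ℝ} (ha : 0 ≤ a) {k : ℝ → ℝ} (hk : IntegrableOn k (Ioo a b))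
    (i : V) : Tendsto (fun n => ∫ t in Ioo a b, f n t i * k t) atTop
      (𝓝 (∫ t in Ioo a b, γ t i * k t)) := by
  have hsub : Ioi (0 : ℝ) ∩ Ioo a b = Ioo a b :=
    inter_eq_right.2 fun t ht => mem_Ioi.2 (ha.trans_lt ht.1)
  have key : ∀ g : ℝ → ℝ, ∫ t in Ioi 0, g t * (Ioo a b).indicator k t
      = ∫ t in Ioo a b, g t * k t := fun g => by
    have h1 : (fun t => g t * (Ioo a b).indicator k t)
        = (Ioo a b).indicator fun t => g t * k t := by
      funext t
      by_cases ht : t ∈ Ioo a b <;> simp [ht]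
    rw [h1, setIntegral_indicator measurableSet_Ioo, hsub]
  have h2 := h i _ (hk.integrable_indicator measurableSet_Ioo).integrableOn
  simpa only [key] using h2

theorem integrableOn_mul_of_bound {f : ℝ → V → ℝ} (hf : Measurable f) {C a b : ℝ}
    (hC : ∀ t ∈ Ioo a b, ∀ i, |f t i| ≤ C) {k : ℝ → ℝ} (hk : IntegrableOn k (Ioo a b)) (i : V) :
    IntegrableOn (fun t => f t i * k t) (Ioo a b) :=
  Integrable.bdd_mul (c := C) hk ((measurable_pi_apply i).comp hf).aestronglyMeasurable
    ((ae_restrict_mem measurableSet_Ioo).mono fun t ht => hC t ht i)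

end WeakConvergence

/-! ### Passage to the limit and existence of solutions. -/

section LimitPassage

variable {V : Type*} [Fintype V] (G : WeightedGraph V) (r : ℝ)

/-- L¹ tests serve both modes of convergence, since on a bounded interval L² is contained in L¹. -/
theorem TendstoWeakly.tendsto_pairing {f : ℕ → ℝ → V → ℝ} {γ : ℝ → V → ℝ}
    (h : TendstoWeakly f γ) (hf : ∀ n, Measurable (f n)) (hγ : Measurable γ) {C : ℝ}
    (hfC : ∀ n, ∀ t > 0, ∀ i, |f n t i| ≤ C) (hγC : ∀ t i, |γ t i| ≤ C) {a b : ℝ} (ha : 0 ≤ a)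
    {k : ℝ → V → ℝ} (hk : MemLpOn 1 a b k) :
    Tendsto (fun n => pairing G r a b (f n) k) atTop (𝓝 (pairing G r a b γ k)) := by
  have hki : ∀ i, IntegrableOn (fun t => k t i) (Ioo a b) := fun i =>
    (memLp_one_iff_integrable.1 hk).eval i
  have h1 : ∀ n, pairing G r a b (f n) k
      = ∑ i, G.deg i ^ r * ∫ t in Ioo a b, f n t i * k t i := fun n =>
    pairing_eq_sum G r fun i =>
      integrableOn_mul_of_bound (hf n) (fun t ht => hfC n t (ha.trans_lt ht.1)) (hki i) i
  have h2 : pairing G r a b γ k = ∑ i, G.deg i ^ r * ∫ t in Ioo a b, γ t i * k t i :=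
    pairing_eq_sum G r fun i => integrableOn_mul_of_bound hγ (fun t _ => hγC t) (hki i) i
  simp only [h1, h2]
  exact tendsto_finsetSum _ fun i _ => (h.tendsto_setIntegral ha (hki i) i).const_mul _

theorem TendstoWeakly.tendsto_integral_avg {f : ℕ → ℝ → V → ℝ} {γ : ℝ → V → ℝ}
    (h : TendstoWeakly f γ) (hf : ∀ n, Measurable (f n)) (hγ : Measurable γ) {C : ℝ}
    (hfC : ∀ n, ∀ t > 0, ∀ i, |f n t i| ≤ C) (hγC : ∀ t i, |γ t i| ≤ C) (b : ℝ) :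
    Tendsto (fun n => ∫ t in Ioo 0 b, avg G r (f n t)) atTop
      (𝓝 (∫ t in Ioo 0 b, avg G r (γ t))) := by
  have h1 : IntegrableOn (fun _ : ℝ => (1 : ℝ)) (Ioo 0 b) := integrableOn_const (by simp)
  have key : ∀ g : ℝ → V → ℝ, Measurable g → (∀ t ∈ Ioo 0 b, ∀ i, |g t i| ≤ C) →
      ∫ t in Ioo 0 b, avg G r (g t)
        = (∑ i, (∫ t in Ioo 0 b, g t i * 1) * G.deg i ^ r) / ∑ i, G.deg i ^ r := by
    intro g hg hgC
    simp only [avg_eq]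
    rw [integral_div, integral_finsetSum]
    · simp only [mul_one, integral_mul_const]
    · intro i _
      have := (integrableOn_mul_of_bound hg hgC h1 i).mul_const (G.deg i ^ r)
      simpa only [mul_one] using this
  rw [key γ hγ fun t _ => hγC t]
  simp only [fun n => key (f n) (hf n) fun t ht => hfC n t ht.1]
  exact (tendsto_finsetSum _ fun i _ =>
    (h.tendsto_setIntegral le_rfl h1 i).mul_const _).div_const _

/-- The velocity `-Δw + ε⁻¹ (w - w̄ + b - b̄)` of the Allen–Cahn flow. -/
def velocity (ε : ℝ) (w b : V → ℝ) (i : V) : ℝ :=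
  -laplacian G r w i + ε⁻¹ * (w i - avg G r w + b i - avg G r b)

theorem measurable_velocity {ε : ℝ} {w b : ℝ → V → ℝ} (hw : Measurable w) (hb : Measurable b) :
    Measurable fun t => velocity G r ε (w t) (b t) := by
  refine measurable_pi_iff.2 fun i => ?_
  have h1 : Measurable fun t => laplacian G r (w t) i :=
    (measurable_pi_apply i).comp ((laplacianCLM G r).continuous.measurable.comp hw)
  have h2 := (continuous_avg G r).measurable.comp hw
  have h3 := (continuous_avg G r).measurable.comp hb
  have h4 := (measurable_pi_apply i).comp hw
  have h5 := (measurable_pi_apply i).comp hb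
  exact h1.neg.add ((((h4.sub h2).add h5).sub h3).const_mul _)

theorem exists_bound_velocity {r : ℝ} (hV : Nontrivial V ∨ r = 0) (ε C : ℝ) :
    ∃ M, ∀ w b : V → ℝ, (∀ i, w i ∈ Icc (0 : ℝ) 1) → (∀ i, |b i| ≤ C) → ∀ i,
      |velocity G r ε w b i| ≤ M := by
  obtain ⟨B, -, hB⟩ := exists_bound_diffusionSlope G r 0
  refine ⟨B + |ε⁻¹| * (2 + 2 * C), fun w b hw hb i => ?_⟩
  have h1 : |laplacian G r w i| ≤ B := by
    have := hB 0 (by simp) w hw i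
    rw [diffusionSlope_zero] at this
    rw [← abs_neg]
    exact this
  refine (abs_add_le _ _).trans (add_le_add (by rwa [abs_neg]) ?_)
  rw [abs_mul]
  refine mul_le_mul_of_nonneg_left ?_ (abs_nonneg _)
  have h3 := avg_mem_Icc G hV hw
  have h4 := abs_le.1 (hb i)
  have h5 := abs_le.1 (abs_avg_le G hV hb)
  rw [abs_le]
  constructor <;> linarith [(hw i).1, (hw i).2, h3.1, h3.2, h4.1, h4.2, h5.1, h5.2]

variable {r}

/-- The limit of the semi-discrete iterates satisfies the integrated Allen–Cahn equation. -/
theorem eq_add_integral_velocity (hV : Nontrivial V ∨ r = 0) {ε : ℝ}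
    {u₀ : V → ℝ} (hu₀ : ∀ i, u₀ i ∈ Icc (0 : ℝ) 1) {τ : ℕ → ℝ} (hτ : ∀ n, 0 < τ n)
    (hτε : ∀ n, τ n < ε) (hτ0 : Tendsto τ atTop (𝓝 0)) {u β : ℕ → ℕ → V → ℝ}
    (h : ∀ n, IsSemiDiscrete G r ε (τ n) u₀ (u n) (β n)) {C L : ℝ}
    (hC : ∀ n m i, |β n (m + 1) i| ≤ C) (hL : ∀ n m i, |u n (m + 1) i - u n m i| ≤ τ n * L)
    {w γ : ℝ → V → ℝ} (hwm : Measurable w) (hw01 : ∀ t i, w t i ∈ Icc (0 : ℝ) 1)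
    (hγm : Measurable γ) (hγC : ∀ t i, |γ t i| ≤ C)
    (hu : ∀ t, 0 ≤ t → Tendsto (fun n => u n ⌈t / τ n⌉₊) atTop (𝓝 (w t)))
    (hβ : TendstoWeakly (fun n t => β n ⌈t / τ n⌉₊) γ) {t : ℝ} (ht : 0 ≤ t) (i : V) :
    w t i = u₀ i + ∫ s in (0 : ℝ)..t, velocity G r ε (w s) (γ s) i := by
  obtain ⟨B, hB0, hB⟩ := exists_bound_diffusionSlope G r ε
  have hu01 : ∀ n m i, u n m i ∈ Icc (0 : ℝ) 1 := fun n => (h n).mem_Icc hu₀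
  have hceil : ∀ n s, 0 < s → ∃ m, ⌈s / τ n⌉₊ = m + 1 := fun n s hs =>
    ⟨⌈s / τ n⌉₊ - 1, by have := Nat.ceil_pos.2 (div_pos hs (hτ n)); omega⟩
  have hβC : ∀ n, ∀ s > 0, ∀ i, |β n ⌈s / τ n⌉₊ i| ≤ C := fun n s hs i => by
    obtain ⟨m, hm⟩ := hceil n s hs
    rw [hm]; exact hC n m i
  have hβm : ∀ n, Measurable fun s : ℝ => β n ⌈s / τ n⌉₊ := fun n => measurable_step (β n) (τ n)
  -- `A` collects the terms that converge pointwise; `D` adds the multiplier, which converges only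
  -- weakly. Diffusion acts on the previous iterate, hence `m - 1`.
  let A : ℕ → ℕ → ℝ := fun n m => diffusionSlope G r (τ n) (u n (m - 1)) i
    + ε⁻¹ * (u n m i - avg G r (u n m))
  let D : ℕ → ℕ → ℝ := fun n m => A n m + ε⁻¹ * (β n m i - avg G r (β n m))
  have hD : ∀ n m, u n (m + 1) i - u n m i = τ n * D n (m + 1) := fun n m => by
    rw [(h n).sub_eq m i]
    simp only [D, A, Nat.add_sub_cancel]
    ring
  have hDb : ∀ n s, 0 < s → |D n ⌈s / τ n⌉₊| ≤ L := fun n s hs => by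
    obtain ⟨m, hm⟩ := hceil n s hs
    have h1 := hL n m i
    rw [hD, abs_mul, abs_of_pos (hτ n)] at h1
    rw [hm]
    exact le_of_mul_le_mul_left h1 (hτ n)
  have hDint : ∀ n a b, 0 ≤ a → 0 ≤ b →
      IntervalIntegrable (fun s : ℝ => D n ⌈s / τ n⌉₊) volume a b := fun n a b ha hb => by
    rw [intervalIntegrable_iff]
    refine Measure.integrableOn_of_bounded (M := L) (by simp)
      (measurable_step (D n) (τ n)).aestronglyMeasurable ?_
    exact (ae_restrict_mem measurableSet_uIoc).mono fun s hs =>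
      hDb n s ((le_min ha hb).trans_lt hs.1)
  have hsum : ∀ n m, u n m i = u₀ i + ∫ s in (0 : ℝ)..(m * τ n), D n ⌈s / τ n⌉₊ := fun n m => by
    rw [integral_step (D n) (hτ n), Finset.mul_sum]
    simp only [← hD]
    rw [Finset.sum_range_sub (fun k => u n k i), (h n).1]
    ring
  have hAb : ∀ n m, |A n m| ≤ B + |ε⁻¹| * 1 := fun n m => by
    refine (abs_add_le _ _).trans
      (add_le_add (hB _ ⟨(hτ n).le, (hτε n).le⟩ _ (hu01 n _) i) ?_)
    rw [abs_mul]
    refine mul_le_mul_of_nonneg_left ?_ (abs_nonneg _)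
    have h1 := hu01 n m i
    have h2 := avg_mem_Icc G hV (hu01 n m)
    rw [abs_le]
    constructor <;> linarith [h1.1, h1.2, h2.1, h2.2]
  have hAlim : ∀ s, 0 < s → Tendsto (fun n => A n ⌈s / τ n⌉₊) atTop
      (𝓝 (-laplacian G r (w s) i + ε⁻¹ * (w s i - avg G r (w s)))) := by
    intro s hs
    have h1 := hu s hs.le
    -- Consecutive iterates differ by at most `τ L`, so the previous one has the same limit.
    have h2 : Tendsto (fun n => u n (⌈s / τ n⌉₊ - 1)) atTop (𝓝 (w s)) := by
      rw [tendsto_pi_nhds] at h1 ⊢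
      intro j
      have h3 : Tendsto (fun n => u n ⌈s / τ n⌉₊ j - u n (⌈s / τ n⌉₊ - 1) j) atTop (𝓝 0) := by
        refine squeeze_zero_norm (fun n => ?_) (by simpa using hτ0.mul_const L)
        obtain ⟨m, hm⟩ := hceil n s hs
        rw [hm, Nat.add_sub_cancel]
        exact hL n m j
      simpa using (h1 j).sub h3
    have h3 : Tendsto (fun n => diffusionSlope G r (τ n)) atTop (𝓝 (-laplacianCLM G r)) := by
      rw [← diffusionSlope_zero]
      exact ((continuous_diffusionSlope G r).tendsto 0).comp hτ0
    have h4 := tendsto_pi_nhds.1 ((isBoundedBilinearMap_apply.continuous.tendsto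
      (-laplacianCLM G r, w s)).comp (h3.prodMk_nhds h2)) i
    exact h4.add (((tendsto_pi_nhds.1 h1 i).sub
      (((continuous_avg G r).tendsto _).comp h1)).const_mul _)
  have hfin : volume (Ioo 0 t) ≠ ⊤ := by simp
  have hbd : ∀ {f : ℝ → ℝ} (M : ℝ), Measurable f → (∀ s ∈ Ioo 0 t, |f s| ≤ M) →
      IntegrableOn f (Ioo 0 t) := fun M hf hM =>
    Measure.integrableOn_of_bounded (M := M) hfin hf.aestronglyMeasurable
      ((ae_restrict_mem measurableSet_Ioo).mono hM)
  have hAint : Tendsto (fun n => ∫ s in Ioo 0 t, A n ⌈s / τ n⌉₊) atTop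
      (𝓝 (∫ s in Ioo 0 t, (-laplacian G r (w s) i + ε⁻¹ * (w s i - avg G r (w s))))) :=
    tendsto_integral_of_dominated_convergence (fun _ => B + |ε⁻¹| * 1)
      (fun n => (measurable_step (A n) (τ n)).aestronglyMeasurable)
      (integrableOn_const hfin) (fun n => Eventually.of_forall fun s => hAb n _)
      ((ae_restrict_mem measurableSet_Ioo).mono fun s hs => hAlim s hs.1)
  have hβint : Tendsto (fun n => ∫ s in Ioo 0 t, β n ⌈s / τ n⌉₊ i) atTop
      (𝓝 (∫ s in Ioo 0 t, γ s i)) := by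
    have := hβ.tendsto_setIntegral le_rfl (b := t) (k := fun _ => 1) (integrableOn_const hfin) i
    simpa only [mul_one] using this
  have hβavg := hβ.tendsto_integral_avg G r hβm hγm hβC hγC t
  have hsplit : ∀ f g k : ℝ → ℝ, IntegrableOn f (Ioo 0 t) → IntegrableOn g (Ioo 0 t) →
      IntegrableOn k (Ioo 0 t) → ∫ s in (0 : ℝ)..t, (f s + ε⁻¹ * (g s - k s))
        = (∫ s in Ioo 0 t, f s) + ε⁻¹ * ((∫ s in Ioo 0 t, g s) - ∫ s in Ioo 0 t, k s) := by
    intro f g k hf hg hk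
    rw [intervalIntegral.integral_of_le ht, integral_Ioc_eq_integral_Ioo, ← integral_sub hg hk,
      ← integral_const_mul]
    exact integral_add hf ((hg.sub hk).const_mul _)
  have hDsplit : ∀ n, ∫ s in (0 : ℝ)..t, D n ⌈s / τ n⌉₊ = (∫ s in Ioo 0 t, A n ⌈s / τ n⌉₊)
      + ε⁻¹ * ((∫ s in Ioo 0 t, β n ⌈s / τ n⌉₊ i) - ∫ s in Ioo 0 t, avg G r (β n ⌈s / τ n⌉₊)) := by
    intro n
    have i1 : IntegrableOn (fun s : ℝ => A n ⌈s / τ n⌉₊) (Ioo 0 t) :=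
      hbd _ (measurable_step (A n) (τ n)) fun s _ => hAb n _
    have i2 : IntegrableOn (fun s : ℝ => β n ⌈s / τ n⌉₊ i) (Ioo 0 t) :=
      hbd C ((measurable_pi_apply i).comp (hβm n)) fun s hs => hβC n s hs.1 i
    have i3 : IntegrableOn (fun s : ℝ => avg G r (β n ⌈s / τ n⌉₊)) (Ioo 0 t) :=
      hbd C ((continuous_avg G r).measurable.comp (hβm n)) fun s hs =>
        abs_avg_le G hV (hβC n s hs.1)
    exact hsplit _ _ _ i1 i2 i3
  have hFsplit : ∫ s in (0 : ℝ)..t, velocity G r ε (w s) (γ s) i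
      = (∫ s in Ioo 0 t, (-laplacian G r (w s) i + ε⁻¹ * (w s i - avg G r (w s))))
        + ε⁻¹ * ((∫ s in Ioo 0 t, γ s i) - ∫ s in Ioo 0 t, avg G r (γ s)) := by
    -- The multiplier-free part is the velocity with multiplier 0, so the bound with `C = 0`
    -- applies.
    obtain ⟨M, hM⟩ := exists_bound_velocity G hV ε 0
    have i1 : IntegrableOn (fun s : ℝ => -laplacian G r (w s) i
        + ε⁻¹ * (w s i - avg G r (w s))) (Ioo 0 t) := by
      have e : (fun s : ℝ => -laplacian G r (w s) i + ε⁻¹ * (w s i - avg G r (w s)))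
          = fun s => velocity G r ε (w s) (fun _ => 0) i := by
        funext s
        simp [velocity, avg_const G hV]
      rw [e]
      exact hbd M ((measurable_pi_apply i).comp (measurable_velocity G r (b := fun _ _ => 0) hwm
        measurable_const)) fun s _ => hM _ _ (hw01 s) (by simp) i
    have i2 : IntegrableOn (fun s : ℝ => γ s i) (Ioo 0 t) :=
      hbd C ((measurable_pi_apply i).comp hγm) fun s _ => hγC s i
    have i3 : IntegrableOn (fun s : ℝ => avg G r (γ s)) (Ioo 0 t) :=
      hbd C ((continuous_avg G r).measurable.comp hγm) fun s _ => abs_avg_le G hV (hγC s)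
    rw [← hsplit _ _ _ i1 i2 i3]
    refine intervalIntegral.integral_congr fun s _ => ?_
    simp only [velocity]
    ring
  have hlim : Tendsto (fun n => ∫ s in (0 : ℝ)..t, D n ⌈s / τ n⌉₊) atTop
      (𝓝 (∫ s in (0 : ℝ)..t, velocity G r ε (w s) (γ s) i)) := by
    simp only [hDsplit, hFsplit]
    exact hAint.add ((hβint.sub hβavg).const_mul _)
  -- The telescoped sum integrates up to the next grid point, overshooting `t` by at most `τ n`.
  have hrest : Tendsto (fun n => ∫ s in t..(⌈t / τ n⌉₊ * τ n), D n ⌈s / τ n⌉₊) atTop (𝓝 0) := by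
    refine squeeze_zero_norm (a := fun n => |L| * τ n) (fun n => ?_)
      (by simpa using hτ0.const_mul |L|)
    have h1 : t ≤ ⌈t / τ n⌉₊ * τ n := (div_le_iff₀ (hτ n)).1 (Nat.le_ceil _)
    have h2 : ⌈t / τ n⌉₊ * τ n ≤ t + τ n := by
      have := (Nat.ceil_lt_add_one (div_nonneg ht (hτ n).le)).le
      calc _ ≤ (t / τ n + 1) * τ n := mul_le_mul_of_nonneg_right this (hτ n).le
        _ = _ := by rw [add_mul, div_mul_cancel₀ _ (hτ n).ne', one_mul]
    refine (intervalIntegral.norm_integral_le_of_norm_le_const (C := |L|) fun s hs => ?_).trans ?_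
    · rw [uIoc_of_le h1] at hs
      exact (hDb n s (ht.trans_lt hs.1)).trans (le_abs_self L)
    · rw [abs_of_nonneg (sub_nonneg.2 h1)]
      exact mul_le_mul_of_nonneg_left (by linarith) (abs_nonneg L)
  refine tendsto_nhds_unique (tendsto_pi_nhds.1 (hu t ht) i) ?_
  have h1 := (hlim.add hrest).const_add (u₀ i)
  rw [add_zero] at h1
  refine h1.congr fun n => ?_
  rw [hsum, intervalIntegral.integral_add_adjacent_intervals (hDint n 0 t le_rfl ht)
    (hDint n t _ ht (mul_nonneg (Nat.cast_nonneg _) (hτ n).le))]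

/-- Needed for `u₀ = 0` and `u₀ = 1`, where the multiplier bound degenerates. -/
theorem isACSolution_const (hV : Nontrivial V ∨ r = 0) (ε c : ℝ) (hc : c ∈ Icc (0 : ℝ) 1) :
    IsACSolution G r ε (Ici 0) (fun _ _ => c) 0 := by
  refine ⟨fun _ _ _ => hc, continuousOn_const, 0, (hasWeakDerivLoc_of_primitive G r (L := 0)
    measurable_const (fun t i => by simp) (fun _ => c) (fun t _ i => by simp)).2,
    Eventually.of_forall fun t => ⟨fun i => ?_, fun i => ⟨hc, by simp, by simp, by simp⟩⟩⟩
  have h1 : laplacian G r (fun _ => c) i = 0 := by simp [laplacian]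
  have h2 : avg G r 0 = 0 := avg_const G hV 0
  simp only [Pi.zero_apply, h1, avg_const G hV, h2]
  ring

/-- Subsequential convergence of the semi-discrete iterates to a solution. -/
theorem exists_subseq_tendsto_solution (hV : Nontrivial V ∨ r = 0) {ε : ℝ} (hε : 0 < ε)
    {u₀ : V → ℝ} (hu₀ : ∀ i, u₀ i ∈ Icc (0 : ℝ) 1) (h0 : u₀ ≠ 0) (h1 : u₀ ≠ 1)
    {τ : ℕ → ℝ} (hτ : ∀ n, 0 < τ n) (hτ0 : Tendsto τ atTop (𝓝 0)) (u β : ℕ → ℕ → V → ℝ)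
    (h : ∀ n, τ n < ε → IsSemiDiscrete G r ε (τ n) u₀ (u n) (β n)) :
    ∃ φ : ℕ → ℕ, StrictMono φ ∧ (∀ n, τ (φ n) < ε) ∧ ∃ uHat γ : ℝ → V → ℝ,
      IsACSolution G r ε (Ici 0) uHat γ ∧ uHat 0 = u₀ ∧
      WeakConvL2Loc G r (Ici 0) (fun n t => β (φ n) ⌈t / τ (φ n)⌉₊) γ ∧
      WeakStarConvLinftyLoc G r (Ici 0) (fun n t => β (φ n) ⌈t / τ (φ n)⌉₊) γ ∧
      (∀ t, 0 ≤ t → Tendsto (fun n => u (φ n) ⌈t / τ (φ n)⌉₊) atTop (𝓝 (uHat t))) ∧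
      ∃ N : ℕ → ℕ, Tendsto N atTop atTop ∧ ∀ᵐ t ∂(volume.restrict (Ici (0 : ℝ))),
        Tendsto (fun k => ((N k : ℝ))⁻¹ • ∑ n ∈ Finset.range (N k), β (φ n) ⌈t / τ (φ n)⌉₊)
          atTop (𝓝 (γ t)) := by
  obtain ⟨C, L, hC, hL, hCL⟩ := exists_bound_isSemiDiscrete G hV hε u₀ hu₀ h0 h1
  obtain ⟨n₀, hn₀⟩ := eventually_atTop.1 (hτ0.eventually_lt_const hε)
  let φ₀ : ℕ → ℕ := fun n => n + n₀
  have hφ₀ : StrictMono φ₀ := fun m n hmn => Nat.add_lt_add_right hmn n₀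
  have hφ₀ε : ∀ n, τ (φ₀ n) < ε := fun n => hn₀ _ (Nat.le_add_left _ _)
  have hφ₀s : ∀ n, IsSemiDiscrete G r ε (τ (φ₀ n)) u₀ (u (φ₀ n)) (β (φ₀ n)) := fun n =>
    h _ (hφ₀ε n)
  have hb := fun n => hCL _ _ _ (hτ (φ₀ n)) (hφ₀ε n) (hφ₀s n)
  obtain ⟨φ₁, y, hφ₁, hy⟩ := exists_subseq_tendsto_pointwise
    (fun n t => u (φ₀ n) ⌈t / τ (φ₀ n)⌉₊) L (fun n => τ (φ₀ n)) (hτ0.comp hφ₀.tendsto_atTop) hL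
    (fun n t _ => (hφ₀s n).mem_Icc hu₀ _)
    (fun n s t hs ht i => abs_step_sub_le (x := fun m => u (φ₀ n) m i) (hτ _) hL
      (fun m => (hb n).2 m i) hs ht)
  have hceil : ∀ n s, 0 < s → ∃ m, ⌈s / τ n⌉₊ = m + 1 := fun n s hs =>
    ⟨⌈s / τ n⌉₊ - 1, by have := Nat.ceil_pos.2 (div_pos hs (hτ n)); omega⟩
  have hβC : ∀ n, ∀ t > 0, ∀ i, |β (φ₀ n) ⌈t / τ (φ₀ n)⌉₊ i| ≤ C := fun n t ht i => by
    obtain ⟨m, hm⟩ := hceil (φ₀ n) t ht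
    rw [hm]; exact (hb n).1 m i
  obtain ⟨φ₂, γ, hφ₂, hγm, hγC, hw, N, hN, hNae⟩ := exists_subseq_weak_cesaro_Ioi
    (fun n t => β (φ₀ (φ₁ n)) ⌈t / τ (φ₀ (φ₁ n))⌉₊) C hC (fun n => measurable_step _ _)
    (fun n => hβC _)
  let φ : ℕ → ℕ := fun n => φ₀ (φ₁ (φ₂ n))
  have hφ : StrictMono φ := hφ₀.comp (hφ₁.comp hφ₂)
  -- `y` is controlled only for `t ≥ 0`; freezing it at negative times gives a measurable,
  -- `[0,1]`-valued limit on the whole line.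
  let w : ℝ → V → ℝ := fun t => y (max t 0)
  have hwlim : ∀ t, Tendsto (fun n => u (φ n) ⌈max t 0 / τ (φ n)⌉₊) atTop (𝓝 (w t)) := fun t =>
    (hy _ (le_max_right t 0)).comp hφ₂.tendsto_atTop
  have hu : ∀ t, 0 ≤ t → Tendsto (fun n => u (φ n) ⌈t / τ (φ n)⌉₊) atTop (𝓝 (w t)) :=
    fun t ht => by simpa only [max_eq_left ht] using hwlim t
  have hwm : Measurable w := by
    refine measurable_of_tendsto_metrizable (f := fun n t => u (φ n) ⌈max t 0 / τ (φ n)⌉₊)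
      (fun n => ?_) (tendsto_pi_nhds.2 hwlim)
    exact (measurable_step (u (φ n)) (τ (φ n))).comp (measurable_id.max measurable_const)
  have hw01 : ∀ t i, w t i ∈ Icc (0 : ℝ) 1 := fun t i =>
    isClosed_Icc.mem_of_tendsto (tendsto_pi_nhds.1 (hwlim t) i)
      (Eventually.of_forall fun n => (hφ₀s _).mem_Icc hu₀ _ i)
  have hweak : TendstoWeakly (fun n t => β (φ n) ⌈t / τ (φ n)⌉₊) γ := hw
  have hint : ∀ t, 0 ≤ t → ∀ i,
      w t i = u₀ i + ∫ s in (0 : ℝ)..t, velocity G r ε (w s) (γ s) i := fun t ht i =>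
    eq_add_integral_velocity G hV hu₀ (fun n => hτ (φ n)) (fun n => hφ₀ε _)
      (hτ0.comp hφ.tendsto_atTop) (fun n => hφ₀s _) (fun n => (hb _).1) (fun n => (hb _).2)
      hwm hw01 hγm hγC hu hweak ht i
  obtain ⟨M, hM⟩ := exists_bound_velocity G hV ε C
  obtain ⟨hwc, hwd⟩ := hasWeakDerivLoc_of_primitive G r (measurable_velocity G r hwm hγm)
    (fun t => hM _ _ (hw01 t) (hγC t)) u₀ hint
  -- The null point `t = 0` is discarded because there the step function takes the arbitrary value
  -- with index 0.
  have hNae' : ∀ᵐ t ∂(volume.restrict (Ici (0 : ℝ))), t ∈ Ioi (0 : ℝ) ∧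
      Tendsto (fun k => ((N k : ℝ))⁻¹ • ∑ n ∈ Finset.range (N k), β (φ n) ⌈t / τ (φ n)⌉₊)
        atTop (𝓝 (γ t)) := by
    rw [← restrict_Ioi_eq_restrict_Ici]
    exact (ae_restrict_mem measurableSet_Ioi).and hNae
  have hβm : ∀ n, Measurable fun t : ℝ => β (φ n) ⌈t / τ (φ n)⌉₊ := fun n => measurable_step _ _
  have hβφC : ∀ n, ∀ t > 0, ∀ i, |β (φ n) ⌈t / τ (φ n)⌉₊ i| ≤ C := fun n => hβC _
  refine ⟨φ, hφ, fun n => hφ₀ε _, w, γ, ⟨fun t _ => hw01 t, hwc, _, hwd, ?_⟩, ?_, ?_, ?_, hu,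
    N, hN, hNae'.mono fun t ht => ht.2⟩
  · refine hNae'.mono fun t ht => ⟨fun i => ?_, ?_⟩
    · simp only [velocity]
      field_simp
      ring
    · refine mem_obstacleSet_of_tendsto_mean (fun n => ?_) (hu t (mem_Ioi.1 ht.1).le) hN ht.2
      obtain ⟨m, hm⟩ := hceil (φ n) t ht.1
      rw [hm]
      exact ((hφ₀s _).2 m).2
  · funext i
    simpa using hint 0 le_rfl i
  · intro a ha b _
    refine ⟨fun n => memLpOn_of_bound (hβm n)
      (fun t ht => hβφC n t ((mem_Ici.1 ha).trans_lt ht.1)) 2,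
      memLpOn_of_bound hγm (fun t _ => hγC t) 2, fun k hk => ?_⟩
    exact hweak.tendsto_pairing G r hβm hγm hβφC hγC ha (MemLp.mono_exponent hk (by norm_num))
  · intro a ha b _
    refine ⟨fun n => memLpOn_of_bound (hβm n)
      (fun t ht => hβφC n t ((mem_Ici.1 ha).trans_lt ht.1)) ⊤,
      memLpOn_of_bound hγm (fun t _ => hγC t) ⊤, fun k hk => ?_⟩
    exact hweak.tendsto_pairing G r hβm hγm hβφC hγC ha hk

/-- Solutions exist for every initial state. -/
theorem exists_isACSolution (hV : Nontrivial V ∨ r = 0) {ε : ℝ} (hε : 0 < ε)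
    (u₀ : V → ℝ) (hu₀ : ∀ i, u₀ i ∈ Icc (0 : ℝ) 1) :
    ∃ u β : ℝ → V → ℝ, IsACSolution G r ε (Ici 0) u β ∧ u 0 = u₀ := by
  rcases eq_or_ne u₀ 0 with rfl | h0
  · exact ⟨_, _, isACSolution_const G hV ε 0 (by simp), rfl⟩
  rcases eq_or_ne u₀ 1 with rfl | h1
  · exact ⟨_, _, isACSolution_const G hV ε 1 (by simp), rfl⟩
  let τ : ℕ → ℝ := fun n => ε / (n + 2)
  have hτ : ∀ n, 0 < τ n := fun n => by positivity
  have hτε : ∀ n, τ n < ε := fun n =>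
    div_lt_self hε (by have : (0 : ℝ) ≤ n := n.cast_nonneg; linarith)
  have hτ0 : Tendsto τ atTop (𝓝 0) :=
    (tendsto_atTop_add_const_right _ 2 tendsto_natCast_atTop_atTop).const_div_atTop ε
  choose u β h using fun n => exists_isSemiDiscrete G hV (hτ n) (hτε n) u₀ hu₀
  obtain ⟨-, -, -, w, γ, hs, hw0, -⟩ :=
    exists_subseq_tendsto_solution G hV hε hu₀ h0 h1 hτ hτ0 u β fun n _ => h n
  exact ⟨w, γ, hs, hw0⟩

end LimitPassage

end GraphAC

end

/-- Existence of solutions, solvability of the semi-discrete scheme for `0 < τ < ε`, and convergence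
of arbitrary semi-discrete iterates along a subsequence. The one-vertex graph, whose only degree is
zero, is admitted only for `r = 0`, since otherwise `⟨1, 1⟩ = 0`. -/
theorem mainTheorem1 {V : Type*} [Fintype V] (G : GraphAC.WeightedGraph V) (r : ℝ)
    (hr : r ∈ Icc (0 : ℝ) 1) (hV : Nontrivial V ∨ r = 0) (ε : ℝ) (hε : 0 < ε)
    (u₀ : V → ℝ) (hu₀ : ∀ i, u₀ i ∈ Icc (0 : ℝ) 1) :
    (∃ u β : ℝ → V → ℝ, GraphAC.IsACSolution G r ε (Ici 0) u β ∧ u 0 = u₀) ∧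
    (∀ τ : ℝ, 0 < τ → τ < ε →
      ∃ u β : ℕ → V → ℝ, GraphAC.IsSemiDiscrete G r ε τ u₀ u β) ∧
    (u₀ ≠ 0 → u₀ ≠ 1 →
      ∀ τ : ℕ → ℝ, (∀ n, 0 < τ n) → Tendsto τ atTop (𝓝 0) →
      ∀ u β : ℕ → ℕ → V → ℝ,
        (∀ n, τ n < ε → GraphAC.IsSemiDiscrete G r ε (τ n) u₀ (u n) (β n)) →
      ∃ φ : ℕ → ℕ, StrictMono φ ∧ (∀ n, τ (φ n) < ε) ∧
        ∃ uHat γ : ℝ → V → ℝ,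
          GraphAC.IsACSolution G r ε (Ici 0) uHat γ ∧ uHat 0 = u₀ ∧
          GraphAC.WeakConvL2Loc G r (Ici 0) (fun n t => β (φ n) ⌈t / τ (φ n)⌉₊) γ ∧
          GraphAC.WeakStarConvLinftyLoc G r (Ici 0) (fun n t => β (φ n) ⌈t / τ (φ n)⌉₊) γ ∧
          (∀ t, 0 ≤ t →
            Tendsto (fun n => u (φ n) ⌈t / τ (φ n)⌉₊) atTop (𝓝 (uHat t))) ∧
          ∃ N : ℕ → ℕ, Tendsto N atTop atTop ∧
            ∀ᵐ t ∂(volume.restrict (Ici (0 : ℝ))),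
              Tendsto
                (fun k => ((N k : ℝ))⁻¹ • ∑ n ∈ Finset.range (N k), β (φ n) ⌈t / τ (φ n)⌉₊)
                atTop (𝓝 (γ t))) :=
  ⟨GraphAC.exists_isACSolution G hV hε u₀ hu₀,
    fun _ hτ hτε => GraphAC.exists_isSemiDiscrete G hV hτ hτε u₀ hu₀,
    fun h0 h1 _ hτ hτ0 u β h =>
      GraphAC.exists_subseq_tendsto_solution G hV hε hu₀ h0 h1 hτ hτ0 u β h⟩
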